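/- **Setting.** Let $M\subset\mathbb R^D$ be a compact $\beta$-smooth submanifold of dimension $d\ge 3$ with $0\in M$, $\operatorname{diam} M\le 1$ and reach $\tau>0$. For $y\in M$ let $\pi_y(x)$ be the orthogonal projection of $x-y$ onto $T_yM$, and let $\Phi_y:B_{T_yM}(0,\tau/8)\to M\cap B(y,\tau/4)$ be the inverse of the (one-to-one) restriction of $\pi_y$ to $M\cap B(y,\tau/4)$. Write $\|f\|_{C^k(U)}=\max_{i\le k}\sup_{z\in U}\|d^if(z)\|_{op}$ and assume $\|\Phi_y\|_{C^\beta(B_{T_yM}(0,\tau/8))}\le L_M$ for all $y\in M$. Let $\mu$ be a probability measure with density $p$ with respect to the $d$-dimensional volume on $M$ such that, for some $L_\mu$, $\|p\circ\Phi_y\|_{C^\alpha(B_{T_yM}(0,\tau/8))}\le L_\mu$ for all $y\in M$, where $\alpha,\beta$ are nonnegative integers with $\alpha+1\le\beta$. Let $C_{\log}>\max(d,4)$ be such that $e^{-C_{\log}}<p(y)<e^{C_{\log}}$ for $y\in M$, $\log\operatorname{Vol}M<e^{C_{\log}}$ and $\min(\tau,L_M^{-1})\ge e^{-C_{\log}}$.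 Let $X$ be the Ornstein–Uhlenbeck process $dX(t)=-X(t)\,dt+\sqrt2\,dB(t)$, $X(0)\sim\mu$, where $B$ is a $D$-dimensional Brownian motion independent of $X(0)$. Put $c_t=e^{-t}$, $\sigma_t=\sqrt{1-e^{-2t}}$, $p(t,x)=\int e^{-\|x-c_ty\|^2/2\sigma_t^2}\,\mu(dy)$ and $s(t,x)=\nabla_x\log p(t,x)$. Let $\hat s:\mathbb R\times\mathbb R^D\to\mathbb R^D$ be any approximation of the score with each $\hat s(t,\cdot)$ measurable, and for $t>0$, $\gamma\ge0$ let $$\widetilde s_{t+\gamma}(t,x,x')=c_\gamma^{-1}\frac{\sigma_{t+\gamma}^2}{\sigma_t^2}\,\hat s(t+\gamma,x')-\frac{x-c_\gamma^{-1}x'}{\sigma_t^2}.$$ Let $0<\kappa<1/4$, $\overline T\ge 1$, $0<\underline T<\overline T$, and let $0=t_0<t_1<\dots<t_K=\overline T-\underline T$ be a $\kappa$-decreasing partition, i.e. $t_{k+1}-t_k\le\kappa\min(1,\overline T-t_k)$ for $0\le k<K$. Let $0\le L\le K$ be the number of steps before the partition reaches $\overline T-1$, i.e. $\overline T-t_k\ge1$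 for $k<L$ and $\overline T-t_k\le 1$ for $L\le k<K$. Put $$\varepsilon_{score}^2=\sum_{k=0}^{K-1}(t_{k+1}-t_k)\,\mathbb E\|\hat s(\overline T-t_k,X(\overline T-t_k))-s(\overline T-t_k,X(\overline T-t_k))\|^2 .$$ **Lemma 6.2.** There is a constant $C$ depending only on $\alpha$ and $\beta$ such that, in this setting, $$\sum_{k=0}^{K-1}\int_{\overline T-t_{k+1}}^{\overline T-t_k}\mathbb E\big\|\widetilde s_{\overline T-t_k}\big(t,X(t),X(\overline T-t_k)\big)-s(t,X(t))\big\|^2\,dt\;\le\; C\Big(\varepsilon_{score}^2+K\kappa^2\big(C_{\log}^3+\log^3\kappa^{-1}\big)+d^3\kappa^5(K-L)^4\Big).$$ -/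

import Mathlib

open MeasureTheory ProbabilityTheory
open scoped NNReal ENNReal

/-! ### Manifolds and densities -/

/-- The ambient space `ℝ^D` with its Euclidean norm. -/
abbrev Amb (D : ℕ) : Type := EuclideanSpace ℝ (Fin D)

/-- `τ` is the reach of `M`: the supremum of the `ε` such that every point at distance less than
`ε` from `M` has exactly one nearest point in `M`. -/
def IsReach {D : ℕ} (M : Set (Amb D)) (τ : ℝ) : Prop :=
  IsLUB {ε : ℝ | ∀ x : Amb D, Metric.infDist x M < ε →
    ∃! y : Amb D, y ∈ M ∧ Metric.infDist x M = dist x y} τ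

/-- The tangent space `T_y M`, as a linear subspace of `ℝ^D`. -/
noncomputable def tangentSubspace {D : ℕ} (M : Set (Amb D)) (y : Amb D) :
    Submodule ℝ (Amb D) :=
  Submodule.span ℝ (tangentConeAt ℝ M y)

/-- The orthogonal projection `π_y` onto the tangent space at `y`, centred so that `π_y y = 0`. -/
noncomputable def tangentProj {D : ℕ} (M : Set (Amb D)) (y x : Amb D) : tangentSubspace M y :=
  (tangentSubspace M y).orthogonalProjectionOnto (x - y)

/-- `Φ` is the inverse projection `Φ_y` on the ball `B_{T_y M}(0, τ/8)`: the inverse of the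
(one-to-one) restriction of `π_y` to `M ∩ B(y, τ/4)`. -/
structure IsInverseProj {D : ℕ} (M : Set (Amb D)) (τ : ℝ) (y : Amb D)
    (Φ : tangentSubspace M y → Amb D) : Prop where
  injOn : Set.InjOn (tangentProj M y) (M ∩ Metric.ball y (τ / 4))
  mapsTo : ∀ z ∈ Metric.ball (0 : tangentSubspace M y) (τ / 8), Φ z ∈ M ∩ Metric.ball y (τ / 4)
  rightInv : ∀ z ∈ Metric.ball (0 : tangentSubspace M y) (τ / 8), tangentProj M y (Φ z) = z

/-- `f` is `k` times continuously differentiable on the open set `U` and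
`‖f‖_{C^k(U)} = max_{i ≤ k} sup_{z ∈ U} ‖d^i f(z)‖_op` is at most `L`. -/
structure CkNormLE {F G : Type*} [NormedAddCommGroup F] [NormedSpace ℝ F]
    [NormedAddCommGroup G] [NormedSpace ℝ G] (k : ℕ) (f : F → G) (U : Set F) (L : ℝ) : Prop where
  contDiffOn : ContDiffOn ℝ k f U
  norm_le : ∀ i ≤ k, ∀ z ∈ U, ‖iteratedFDeriv ℝ i f z‖ ≤ L

/-- `M` is a compact `β`-smooth `d`-dimensional submanifold of `ℝ^D`, `d ≥ 3`, of positive reach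
`τ`, all of whose inverse projections `Φ_y` have `C^β` norm at most `LM`. -/
structure IsRegularManifold {D : ℕ} (d β : ℕ) (M : Set (Amb D)) (τ LM : ℝ) : Prop where
  compact : IsCompact M
  three_le : 3 ≤ d
  reach : IsReach M τ
  reach_pos : 0 < τ
  const_pos : 0 < LM
  finrank_tangent : ∀ y ∈ M, Module.finrank ℝ (tangentSubspace M y) = d
  charts : ∀ y ∈ M, ∃ Φ : tangentSubspace M y → Amb D, IsInverseProj M τ y Φ ∧
    CkNormLE β Φ (Metric.ball 0 (τ / 8)) LM

/-- `μ` has the `α`-smooth density `p` with respect to the `d`-dimensional volume element of `M`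
(the Hausdorff measure `μHE[d]`, normalized to agree with Lebesgue measure on `ℝ^d`), with the
`C^α` norms of `p ∘ Φ_y` bounded uniformly in `y ∈ M`. -/
structure HasRegularDensity {D : ℕ} (d α : ℕ) (M : Set (Amb D)) (τ : ℝ) (μ : Measure (Amb D))
    (p : Amb D → ℝ) : Prop where
  measurable : Measurable p
  density : μ = (μHE[d].restrict M).withDensity fun y => ENNReal.ofReal (p y)
  smooth : ∃ Lμ : ℝ, ∀ y ∈ M, ∀ Φ : tangentSubspace M y → Amb D, IsInverseProj M τ y Φ →
    CkNormLE α (fun z => p (Φ z)) (Metric.ball 0 (τ / 8)) Lμ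

/-- `Clog` is an admissible log-complexity constant of the measure with density `p` on `M`. -/
structure IsLogComplexity {D : ℕ} (d : ℕ) (M : Set (Amb D)) (τ LM : ℝ) (p : Amb D → ℝ)
    (Clog : ℝ) : Prop where
  gt_max : max (d : ℝ) 4 < Clog
  density_gt : ∀ y ∈ M, Real.exp (-Clog) < p y
  density_lt : ∀ y ∈ M, p y < Real.exp Clog
  log_vol_lt : Real.log (μHE[d] M).toReal < Real.exp Clog
  le_min : Real.exp (-Clog) ≤ min τ LM⁻¹

/-- All assumptions on `μ`, including the normalization `0 ∈ M`, `diam M ≤ 1`. -/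
structure IsAdmissible {D : ℕ} (d α β : ℕ) (μ : Measure (Amb D)) (Clog : ℝ) (M : Set (Amb D))
    (τ LM : ℝ) (p : Amb D → ℝ) : Prop where
  smoothness : α + 1 ≤ β
  manifold : IsRegularManifold d β M τ LM
  density : HasRegularDensity d α M τ μ p
  log_complexity : IsLogComplexity d M τ LM p Clog
  zero_mem : (0 : Amb D) ∈ M
  diam_le : Metric.diam M ≤ 1

/-! ### The forward process and the scores -/

/-- `c_t = e^{-t}`. -/
noncomputable def ouC (t : ℝ) : ℝ := Real.exp (-t)

/-- `σ_t = √(1 - e^{-2t})`. -/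
noncomputable def ouSigma (t : ℝ) : ℝ := Real.sqrt (1 - Real.exp (-2 * t))

/-- A `D`-dimensional Brownian motion: its coordinates are independent real Brownian motions. -/
structure IsBrownianVec {D : ℕ} {Ω : Type*} [MeasurableSpace Ω] (B : ℝ≥0 → Ω → Amb D)
    (P : Measure Ω) : Prop where
  measurable : ∀ t, Measurable (B t)
  coord : ∀ i : Fin D, IsBrownianReal (fun t ω => B t ω i) P
  indep : iIndepFun (fun (i : Fin D) ω (t : ℝ≥0) => B t ω i) P

/-- `X` is the forward (Ornstein-Uhlenbeck) process: a continuous solution of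
`dX(t) = -X(t) dt + √2 dB(t)`, `X(0) ∼ μ`, driven by a Brownian motion independent of `X(0)`.
The noise being additive, the equation is read pathwise in its integrated form. -/
structure IsForwardProcess {D : ℕ} {Ω : Type*} [MeasurableSpace Ω] (μ : Measure (Amb D))
    (X : ℝ≥0 → Ω → Amb D) (P : Measure Ω) : Prop where
  measurable : ∀ t, Measurable (X t)
  law_zero : P.map (X 0) = μ
  sde : ∃ B : ℝ≥0 → Ω → Amb D, IsBrownianVec B P ∧
    IndepFun (X 0) (fun ω (t : ℝ≥0) => B t ω) P ∧
    ∀ᵐ ω ∂P, Continuous (fun t => X t ω) ∧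
      ∀ t : ℝ≥0, X t ω =
        X 0 ω - (∫ s in (0 : ℝ)..(t : ℝ), X s.toNNReal ω) + Real.sqrt 2 • B t ω

/-- The (unnormalized) density `p(t, x)` of `X(t)`. -/
noncomputable def marginalDensity {D : ℕ} (μ : Measure (Amb D)) (t : ℝ) (x : Amb D) : ℝ :=
  ∫ y, Real.exp (-‖x - ouC t • y‖ ^ 2 / (2 * ouSigma t ^ 2)) ∂μ

/-- The score `s(t, x) = ∇ log p(t, x)`. -/
noncomputable def score {D : ℕ} (μ : Measure (Amb D)) (t : ℝ) (x : Amb D) : Amb D :=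
  gradient (fun x' => Real.log (marginalDensity μ t x')) x

/-- The drift `s̃_r(t, x, x')` of the modified scheme built from an approximate score `shat`; here
`r = t + γ` is the time of the previous grid point:
`c_γ⁻¹ (σ_r² / σ_t²) shat(r, x') - (x - c_γ⁻¹ x') / σ_t²`. -/
noncomputable def modifiedScore {D : ℕ} (shat : ℝ → Amb D → Amb D) (r t : ℝ) (x x' : Amb D) :
    Amb D :=
  ((ouC (r - t))⁻¹ * (ouSigma r ^ 2 / ouSigma t ^ 2)) • shat r x' -
    (ouSigma t ^ 2)⁻¹ • (x - (ouC (r - t))⁻¹ • x')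

/-! ### Time grids and losses -/

/-- `0 = t 0 < t 1 < ⋯ < t K = Thi - Tlo` is a `κ`-decreasing partition. -/
structure IsDecreasingPartition (κ Thi Tlo : ℝ) (K : ℕ) (t : ℕ → ℝ) : Prop where
  zero : t 0 = 0
  last : t K = Thi - Tlo
  strict : ∀ k < K, t k < t (k + 1)
  step : ∀ k < K, t (k + 1) - t k ≤ κ * min 1 (Thi - t k)

/-- `ε_score²`, the weighted sum of the mean squared errors of `shat` at the grid times `Thi - t k`
along the process `X`. -/
noncomputable def scoreErrorSq {D : ℕ} {Ω : Type*} [MeasurableSpace Ω] (P : Measure Ω)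
    (μ : Measure (Amb D)) (X : ℝ≥0 → Ω → Amb D) (shat : ℝ → Amb D → Amb D) (Thi : ℝ) (K : ℕ)
    (t : ℕ → ℝ) : ℝ≥0∞ :=
  ∑ k ∈ Finset.range K, ENNReal.ofReal (t (k + 1) - t k) *
    ∫⁻ ω, ‖shat (Thi - t k) (X (Thi - t k).toNNReal ω) -
      score μ (Thi - t k) (X (Thi - t k).toNNReal ω)‖ₑ ^ 2 ∂P

/-- The continuous-time score-matching loss of the modified scheme, summed over all steps. -/
noncomputable def modifiedLoss {D : ℕ} {Ω : Type*} [MeasurableSpace Ω] (P : Measure Ω)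
    (μ : Measure (Amb D)) (X : ℝ≥0 → Ω → Amb D) (shat : ℝ → Amb D → Amb D) (Thi : ℝ) (K : ℕ)
    (t : ℕ → ℝ) : ℝ≥0∞ :=
  ∑ k ∈ Finset.range K, ∫⁻ s in Set.Icc (Thi - t (k + 1)) (Thi - t k),
    ∫⁻ ω, ‖modifiedScore shat (Thi - t k) s (X s.toNNReal ω) (X (Thi - t k).toNNReal ω) -
      score μ s (X s.toNNReal ω)‖ₑ ^ 2 ∂P

/-! Write `V s` for the minimal mean squared error of estimating the clean point `X(0)` from `X(s)`.
By Tweedie's formula the score is an affine function of the posterior mean of `X(0)`. The modified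
drift is built so that, with the exact score in place of `shat`, all terms in `x` and `x'` cancel:
what remains of the error is a bounded multiple of the score error at the grid time `r`, plus `c_s /
σ_s²` times the increment of the posterior mean between `X(r)` and `X(s)`
(`modifiedScore_sub_score`).

For `s ≤ r`, `X(r)` is a rescaled copy of `X(s)` with independent Gaussian noise added, so the
posterior mean given `X(r)` is a coarser projection of `X(0)` than the one given `X(s)`. Pythagoras
gives exactly `V r - V s` for the mean squared increment (`integral_norm_postMean_sub_sq`). With
remaining times `r_k`, the discretization error is thus at most a constant times the sum of `(r_k -
r_{k+1}) / min(1, r_k)² * (V(r_k) - V(r_{k+1}))`.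

The step condition turns one factor into `κ`. Summation by parts then moves the difference from `V`
to `1 / min(1, r_k)`, and each new term is controlled as soon as `V s` is at most of order `s (Clog²
+ d log(1/s))`. That is a small-ball estimate: `mmse_le_of_measure_closedBall` bounds the error by
the log-mass of balls of radius `σ_s`, and a ball of radius `ρ` centred on `M` has mass at least of
order `ρ^d`, up to powers of the constants (`IsAdmissible.le_measureReal_closedBall`). Finally
`log(1 / r_j)` is at most `2 κ (j - L + 1)`, because the remaining times decay at most
geometrically; this produces the term in `(K - L)^4`. The boundary term `4 κ` of the summation by
parts is absorbed by `K κ²` only if `K κ ≥ 1/4`; otherwise the grid stays away from time zero and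
Lipschitz continuity of `V` there suffices (`sum_grid_le`).

The process enters only through the joint law of `(X(s), X(r))`, obtained from the pathwise equation
by Riemann sums and characteristic functions (`IsForwardProcess.map_pair`). -/

set_option linter.unusedSectionVars false

/-! ### Translation and rotation of the standard Gaussian measure. -/

section GaussianShift

variable {E : Type*} [NormedAddCommGroup E] [InnerProductSpace ℝ E] [FiniteDimensional ℝ E]
  [MeasurableSpace E] [BorelSpace E]

open scoped RealInnerProductSpace

lemma stdGaussian_eq_tilted_volume :
    stdGaussian E = (volume : Measure E).tilted (fun x => -(1 / 2) * ‖x‖ ^ 2) := by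
  have hZ : Integrable (fun x : E => Real.exp (-(1 / 2) * ‖x‖ ^ 2)) := by
    have h := (GaussianFourier.integrable_cexp_neg_mul_sq_norm_add (V := E) (b := (1 / 2 : ℂ))
      (by norm_num) 0 0).norm
    refine h.congr (Filter.Eventually.of_forall fun x => ?_)
    simp only [Complex.norm_exp]
    congr 1
    simp [← Complex.ofReal_pow]
  have : IsProbabilityMeasure ((volume : Measure E).tilted (fun x => -(1 / 2) * ‖x‖ ^ 2)) :=
    isProbabilityMeasure_tilted hZ
  refine Measure.ext_of_charFun ?_
  ext t
  rw [charFun_stdGaussian, charFun_apply, integral_tilted]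
  have h2 := GaussianFourier.integral_rexp_neg_mul_sq_norm (V := E) (b := 1 / 2) (by norm_num)
  have h1 := GaussianFourier.integral_cexp_neg_mul_sq_norm_add (V := E) (b := (1 / 2 : ℂ))
      (by norm_num) Complex.I t
  rw [h2]
  have hpi : (Real.pi / (1 / 2) : ℝ) ^ (Module.finrank ℝ E / 2 : ℝ) ≠ 0 := by positivity
  have h3 : ∀ x : E, (Real.exp (-(1 / 2) * ‖x‖ ^ 2) /
      (Real.pi / (1 / 2)) ^ (Module.finrank ℝ E / 2 : ℝ)) • Complex.exp (⟪x, t⟫ * Complex.I) =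
      (((Real.pi / (1 / 2) : ℝ) ^ (Module.finrank ℝ E / 2 : ℝ) : ℝ) : ℂ)⁻¹ *
        Complex.exp (-(1 / 2) * ‖x‖ ^ 2 + Complex.I * ⟪t, x⟫) := by
    intro x
    rw [Complex.exp_add, Complex.real_smul, real_inner_comm]
    push_cast
    rw [mul_comm Complex.I]
    ring
  simp_rw [h3]
  rw [integral_const_mul, h1]
  have h4 : ((Real.pi : ℂ) / (1 / 2)) ^ ((Module.finrank ℝ E : ℂ) / 2) =
      (((Real.pi / (1 / 2) : ℝ) ^ (Module.finrank ℝ E / 2 : ℝ) : ℝ) : ℂ) := by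
    rw [Complex.ofReal_cpow (by positivity)]
    push_cast
    rfl
  rw [h4, ← mul_assoc, inv_mul_cancel₀ (by exact_mod_cast hpi), one_mul]
  congr 1
  simp
  ring

/-- The Cameron-Martin formula in finite dimension. -/
lemma integral_add_stdGaussian {F : Type*} [NormedAddCommGroup F] [NormedSpace ℝ F]
    (f : E → F) (v : E) :
    ∫ z, f (v + z) ∂stdGaussian E =
      ∫ z, Real.exp (⟪v, z⟫ - ‖v‖ ^ 2 / 2) • f z ∂stdGaussian E := by
  rw [stdGaussian_eq_tilted_volume, integral_tilted, integral_tilted,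
    ← integral_add_left_eq_self (μ := (volume : Measure E)) _ (-v)]
  refine integral_congr_ae (Filter.Eventually.of_forall fun x => ?_)
  simp only
  rw [add_neg_cancel_left, smul_smul, div_mul_eq_mul_div, ← Real.exp_add]
  congr 3
  rw [neg_add_eq_sub, norm_sub_sq_real, real_inner_comm]
  ring

lemma integral_exp_inner_stdGaussian (v : E) :
    ∫ z, Real.exp ⟪v, z⟫ ∂stdGaussian E = Real.exp (‖v‖ ^ 2 / 2) := by
  have h := integral_add_stdGaussian (fun _ : E => (1 : ℝ)) v
  simp only [integral_const, probReal_univ, smul_eq_mul, mul_one, Real.exp_sub,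
    div_eq_mul_inv] at h
  rw [integral_mul_const] at h
  field_simp at h
  simpa using h.symm

lemma integrable_exp_inner_stdGaussian (v : E) :
    Integrable (fun z => Real.exp ⟪v, z⟫) (stdGaussian E) := by
  -- A non-integrable function has integral `0` by convention, whereas the value just computed is
  -- positive.
  by_contra h
  have := integral_exp_inner_stdGaussian v
  rw [integral_undef h] at this
  exact (Real.exp_pos _).ne this

lemma integral_inner_stdGaussian (v : E) : ∫ z, ⟪v, z⟫ ∂stdGaussian E = 0 := by
  have h := integral_strongDual_stdGaussian (innerSL ℝ v)
  simpa using h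

lemma integrable_inner_stdGaussian (v : E) : Integrable (fun z => ⟪v, z⟫) (stdGaussian E) := by
  have h : Integrable (fun z : E => z) (stdGaussian E) := IsGaussian.integrable_id
  exact h.const_inner v

/-- Rotation invariance: `b z + e z'` is standard Gaussian if `b² + e² = 1`. -/
lemma map_smul_add_smul_stdGaussian {b e : ℝ} (h : b ^ 2 + e ^ 2 = 1) :
    ((stdGaussian E).prod (stdGaussian E)).map (fun p => b • p.1 + e • p.2) = stdGaussian E := by
  have : IsProbabilityMeasure
      (((stdGaussian E).prod (stdGaussian E)).map (fun p => b • p.1 + e • p.2)) :=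
    Measure.isProbabilityMeasure_map (by fun_prop)
  refine Measure.ext_of_charFun ?_
  ext t
  rw [charFun_apply, integral_map (by fun_prop) (by fun_prop)]
  have h1 : ∀ p : E × E, Complex.exp (⟪b • p.1 + e • p.2, t⟫ * Complex.I) =
      Complex.exp (⟪p.1, b • t⟫ * Complex.I) * Complex.exp (⟪p.2, e • t⟫ * Complex.I) := by
    intro p
    rw [← Complex.exp_add, inner_add_left, real_inner_smul_left, real_inner_smul_left,
      real_inner_smul_right, real_inner_smul_right]
    congr 1
    push_cast
    ring
  simp_rw [h1]
  rw [integral_prod_mul (fun z : E => Complex.exp (⟪z, b • t⟫ * Complex.I))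
    (fun z : E => Complex.exp (⟪z, e • t⟫ * Complex.I)), ← charFun_apply, ← charFun_apply,
    charFun_stdGaussian, charFun_stdGaussian, charFun_stdGaussian, ← Complex.exp_add]
  congr 1
  rw [norm_smul, norm_smul, Real.norm_eq_abs, Real.norm_eq_abs]
  have h2 : |b| ^ 2 + |e| ^ 2 = 1 := by simpa using h
  have h3 : ((|b| : ℝ) : ℂ) ^ 2 + ((|e| : ℝ) : ℂ) ^ 2 = 1 := by exact_mod_cast h2
  push_cast
  linear_combination (-(‖t‖ : ℂ) ^ 2 / 2) * h3

end GaussianShift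

/-! ### Bayesian estimation from a Gaussian observation `a y + z`. -/

section GaussianChannel

variable {E : Type*} [NormedAddCommGroup E] [InnerProductSpace ℝ E] [FiniteDimensional ℝ E]
  [MeasurableSpace E] [BorelSpace E]

open scoped RealInnerProductSpace

/-- The measure is carried by the compact unit ball, where `f` is bounded. Tilts keep this property,
so the same argument serves for posteriors. -/
lemma integrable_of_continuous_of_ae_norm_le {F : Type*} [NormedAddCommGroup F]
    {μ : Measure E} [IsFiniteMeasure μ] (hμ : ∀ᵐ y ∂μ, ‖y‖ ≤ 1) {f : E → F} (hf : Continuous f) :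
    Integrable f μ := by
  obtain ⟨C, hC⟩ := (isCompact_closedBall (0 : E) 1).exists_bound_of_continuousOn hf.continuousOn
  refine Integrable.of_bound hf.aestronglyMeasurable C ?_
  filter_upwards [hμ] with y hy
  exact hC y (by simpa using hy)

lemma isProbabilityMeasure_tilted_of_continuous {μ : Measure E} [IsProbabilityMeasure μ]
    (hμ : ∀ᵐ y ∂μ, ‖y‖ ≤ 1) {φ : E → ℝ} (hφ : Continuous φ) :
    IsProbabilityMeasure (μ.tilted φ) :=
  isProbabilityMeasure_tilted (integrable_of_continuous_of_ae_norm_le hμ (by fun_prop))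

lemma ae_norm_le_tilted {μ : Measure E} (hμ : ∀ᵐ y ∂μ, ‖y‖ ≤ 1) (φ : E → ℝ) :
    ∀ᵐ y ∂μ.tilted φ, ‖y‖ ≤ 1 :=
  (tilted_absolutelyContinuous μ φ).ae_le hμ

lemma norm_integral_id_le_one {μ : Measure E} [IsProbabilityMeasure μ]
    (hμ : ∀ᵐ y ∂μ, ‖y‖ ≤ 1) : ‖∫ y, y ∂μ‖ ≤ 1 := by
  simpa using norm_integral_le_of_norm_le_const hμ

lemma measurable_integral_tilted {μ : Measure E} [IsProbabilityMeasure μ]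
    {φ : E → E → ℝ} (hφ : Continuous φ.uncurry) :
    Measurable fun w => ∫ y, y ∂μ.tilted (φ w) := by
  simp_rw [integral_tilted]
  refine StronglyMeasurable.measurable ?_
  have hZ : StronglyMeasurable fun w => ∫ y, Real.exp (φ w y) ∂μ :=
    StronglyMeasurable.integral_prod_right' (f := fun p : E × E => Real.exp (φ p.1 p.2))
      (Real.continuous_exp.comp hφ).stronglyMeasurable
  refine StronglyMeasurable.integral_prod_right'
    (f := fun p : E × E => (Real.exp (φ p.1 p.2) / ∫ x, Real.exp (φ p.1 x) ∂μ) • p.2) ?_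
  refine StronglyMeasurable.smul ?_ measurable_snd.stronglyMeasurable
  exact ((Real.continuous_exp.comp hφ).measurable.div
    (hZ.measurable.comp measurable_fst)).stronglyMeasurable

/-- The log-likelihood of the signal `y` given the observation `w = a y + z`, up to a term that
does not depend on `y`. -/
noncomputable def logLik (a : ℝ) (w y : E) : ℝ := a * ⟪y, w⟫ - a ^ 2 * ‖y‖ ^ 2 / 2

@[fun_prop]
lemma continuous_logLik {X : Type*} [TopologicalSpace X] (a : ℝ) (w : E) {f : X → E}
    (hf : Continuous f) : Continuous fun x => logLik a w (f x) := by
  unfold logLik; fun_prop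

lemma continuous_uncurry_logLik (a : ℝ) : Continuous (Function.uncurry (logLik (E := E) a)) := by
  unfold logLik Function.uncurry; fun_prop

/-- The posterior mean of the signal `y ∼ μ` given the observation `w = a y + z`. -/
noncomputable def postMean (μ : Measure E) (a : ℝ) (w : E) : E := ∫ y, y ∂μ.tilted (logLik a w)

/-- The minimal mean squared error of estimating `y ∼ μ` from `a y + z`. -/
noncomputable def mmse (μ : Measure E) (a : ℝ) : ℝ :=
  ∫ p, ‖p.1 - postMean μ a (a • p.1 + p.2)‖ ^ 2 ∂(μ.prod (stdGaussian E))

variable {μ : Measure E} [IsProbabilityMeasure μ]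

lemma norm_postMean_le (hμ : ∀ᵐ y ∂μ, ‖y‖ ≤ 1) (a : ℝ) (w : E) : ‖postMean μ a w‖ ≤ 1 := by
  have := isProbabilityMeasure_tilted_of_continuous (φ := logLik a w) hμ
    (continuous_logLik a w continuous_id)
  exact norm_integral_id_le_one (ae_norm_le_tilted hμ _)

@[fun_prop]
lemma measurable_postMean (a : ℝ) : Measurable (postMean μ a) :=
  measurable_integral_tilted (continuous_uncurry_logLik a)

lemma ae_norm_fst_le {α : Type*} [MeasurableSpace α] {ν : Measure α} [SFinite ν]
    (hμ : ∀ᵐ y ∂μ, ‖y‖ ≤ 1) : ∀ᵐ p ∂μ.prod ν, ‖p.1‖ ≤ 1 :=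
  Measure.quasiMeasurePreserving_fst.ae hμ

lemma integrable_prod_of_bound {F α : Type*} [NormedAddCommGroup F] [MeasurableSpace α]
    {ν : Measure α} [IsFiniteMeasure ν] (hμ : ∀ᵐ y ∂μ, ‖y‖ ≤ 1) {f : E × α → F}
    (hf : AEStronglyMeasurable f (μ.prod ν)) {C : ℝ} (hC : ∀ p, ‖p.1‖ ≤ 1 → ‖f p‖ ≤ C) :
    Integrable f (μ.prod ν) := by
  refine Integrable.of_bound hf C ?_
  filter_upwards [ae_norm_fst_le hμ] with p hp using hC p hp

/-- For fixed `y` the integrand is the density of `N(a y, I)` with respect to `N(0, I)`, so its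
integral over the noise is `1`. -/
lemma integrable_exp_logLik (a : ℝ) :
    Integrable (fun p : E × E => Real.exp (logLik a p.2 p.1)) (μ.prod (stdGaussian E)) := by
  have hc : Continuous fun p : E × E => Real.exp (logLik a p.2 p.1) :=
    Real.continuous_exp.comp ((continuous_uncurry_logLik a).comp continuous_swap)
  have h1 : ∀ y z : E, Real.exp (logLik a z y) =
      Real.exp (-(a ^ 2 * ‖y‖ ^ 2 / 2)) * Real.exp ⟪a • y, z⟫ := by
    intro y z
    rw [← Real.exp_add, logLik, real_inner_smul_left]
    congr 1; ring
  rw [integrable_prod_iff hc.aestronglyMeasurable]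
  refine ⟨Filter.Eventually.of_forall fun y => ?_, ?_⟩
  · simp only [h1]
    exact (integrable_exp_inner_stdGaussian _).const_mul _
  · refine (integrable_const (1 : ℝ)).congr (Filter.Eventually.of_forall fun y => ?_)
    simp only [Real.norm_eq_abs, Real.abs_exp]
    simp_rw [h1]
    rw [integral_const_mul, integral_exp_inner_stdGaussian, ← Real.exp_add, norm_smul, mul_pow,
      Real.norm_eq_abs, sq_abs, neg_add_cancel, Real.exp_zero]

/-- Bayes' formula: integration against the joint law of the signal `y` and the observation
`a y + z`. -/
lemma integral_channel (hμ : ∀ᵐ y ∂μ, ‖y‖ ≤ 1) (a : ℝ) {g : E → E → ℝ}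
    (hg : Measurable g.uncurry) {C : ℝ} (hC : ∀ y w, ‖y‖ ≤ 1 → |g y w| ≤ C) :
    ∫ p, g p.1 (a • p.1 + p.2) ∂(μ.prod (stdGaussian E)) =
      ∫ w, ∫ y, Real.exp (logLik a w y) * g y w ∂μ ∂stdGaussian E := by
  rw [integral_prod]
  · have h1 : ∀ y : E, ∫ z, g y (a • y + z) ∂stdGaussian E =
        ∫ z, Real.exp (logLik a z y) * g y z ∂stdGaussian E := by
      intro y
      rw [integral_add_stdGaussian (fun z => g y z)]
      refine integral_congr_ae (Filter.Eventually.of_forall fun z => ?_)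
      simp only [smul_eq_mul, logLik, real_inner_smul_left, norm_smul, mul_pow, Real.norm_eq_abs,
        sq_abs]
    simp_rw [h1]
    rw [integral_integral_swap]
    refine Integrable.mul_bdd (c := C) (integrable_exp_logLik a) hg.aestronglyMeasurable ?_
    filter_upwards [ae_norm_fst_le hμ] with p hp using hC _ _ hp
  · refine integrable_prod_of_bound hμ ?_ (C := C) (fun p hp => hC _ _ hp)
    have h : Measurable fun p : E × E => (p.1, a • p.1 + p.2) := by fun_prop
    exact (hg.comp h).aestronglyMeasurable

/-- The error of the posterior mean is orthogonal to functions of the observation. -/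
lemma integral_inner_sub_postMean (hμ : ∀ᵐ y ∂μ, ‖y‖ ≤ 1) (a : ℝ) {ψ : E → E}
    (hψ : Measurable ψ) {C : ℝ} (hC : ∀ w, ‖ψ w‖ ≤ C) :
    ∫ p, ⟪p.1 - postMean μ a (a • p.1 + p.2), ψ (a • p.1 + p.2)⟫ ∂(μ.prod (stdGaussian E)) =
      0 := by
  rw [integral_channel hμ a (g := fun y w => ⟪y - postMean μ a w, ψ w⟫) (C := 2 * C)]
  · refine integral_eq_zero_of_ae (Filter.Eventually.of_forall fun w => ?_)
    have hZ : Integrable (fun y => Real.exp (logLik a w y)) μ :=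
      integrable_of_continuous_of_ae_norm_le hμ (by fun_prop)
    have hN : Integrable (fun y => Real.exp (logLik a w y) • y) μ :=
      integrable_of_continuous_of_ae_norm_le hμ (by fun_prop)
    have h0 : 0 < ∫ y, Real.exp (logLik a w y) ∂μ := integral_exp_pos hZ
    -- The posterior mean is the barycentre of the weights `exp (logLik a w y)`; for fixed `w` the
    -- second factor `ψ w` is constant and comes out.
    have h1 : ∫ y, Real.exp (logLik a w y) • (y - postMean μ a w) ∂μ = 0 := by
      simp_rw [smul_sub]
      rw [integral_sub hN (hZ.smul_const _), integral_smul_const, postMean, integral_tilted]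
      simp_rw [div_eq_inv_mul, mul_smul]
      rw [integral_smul, smul_smul, mul_inv_cancel₀ h0.ne', one_smul, sub_self]
    have h2 : ∀ y, Real.exp (logLik a w y) * ⟪y - postMean μ a w, ψ w⟫ =
        ⟪ψ w, Real.exp (logLik a w y) • (y - postMean μ a w)⟫ := by
      intro y
      rw [real_inner_smul_right, real_inner_comm]
    simp only [h2, Pi.zero_apply]
    rw [integral_inner (by simp_rw [smul_sub]; exact hN.sub (hZ.smul_const _)), h1,
      inner_zero_right]
  · have : Measurable fun p : E × E => ⟪p.1 - postMean μ a p.2, ψ p.2⟫ :=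
      Measurable.inner (by fun_prop) (by fun_prop)
    exact this
  · intro y w hy
    refine (abs_real_inner_le_norm _ _).trans ?_
    have h1 : ‖y - postMean μ a w‖ ≤ 2 := by
      have := norm_sub_le y (postMean μ a w)
      have := norm_postMean_le hμ a w
      linarith
    exact mul_le_mul h1 (hC w) (norm_nonneg _) (by norm_num)

end GaussianChannel

/-! ### Orthogonality relations for the minimal mean squared error. -/

section MeanSquaredError

variable {E : Type*} [NormedAddCommGroup E] [InnerProductSpace ℝ E] [FiniteDimensional ℝ E]
  [MeasurableSpace E] [BorelSpace E] {μ : Measure E} [IsProbabilityMeasure μ]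

open scoped RealInnerProductSpace

lemma norm_sub_sq_le_four {x y : E} (hx : ‖x‖ ≤ 1) (hy : ‖y‖ ≤ 1) : ‖x - y‖ ^ 2 ≤ 4 := by
  have h1 : ‖x - y‖ ≤ 2 := (norm_sub_le x y).trans (by linarith)
  nlinarith [norm_nonneg (x - y)]

lemma measurable_channel (a : ℝ) : Measurable fun p : E × E => a • p.1 + p.2 := by fun_prop

lemma integrable_norm_sub_sq (hμ : ∀ᵐ y ∂μ, ‖y‖ ≤ 1) (a : ℝ) {f : E → E} (hf : Measurable f)
    (hb : ∀ w, ‖f w‖ ≤ 1) :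
    Integrable (fun p : E × E => ‖p.1 - f (a • p.1 + p.2)‖ ^ 2) (μ.prod (stdGaussian E)) := by
  have h : Measurable fun p : E × E => f (a • p.1 + p.2) := hf.comp (measurable_channel a)
  refine integrable_prod_of_bound hμ (C := 4) ?_ fun p hp => ?_
  · exact ((measurable_fst.sub h).norm.pow_const 2).aestronglyMeasurable
  · rw [Real.norm_of_nonneg (by positivity)]
    exact norm_sub_sq_le_four hp (hb _)

lemma mmse_nonneg (a : ℝ) : 0 ≤ mmse μ a := integral_nonneg fun _ => by positivity

lemma mmse_le_four (hμ : ∀ᵐ y ∂μ, ‖y‖ ≤ 1) (a : ℝ) : mmse μ a ≤ 4 := by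
  have h := integral_mono_ae (μ := μ.prod (stdGaussian E))
    (integrable_norm_sub_sq hμ a (measurable_postMean a) (norm_postMean_le hμ a))
    (integrable_const (4 : ℝ)) (by
      filter_upwards [ae_norm_fst_le hμ] with p hp
      exact norm_sub_sq_le_four hp (norm_postMean_le hμ a _))
  simpa [mmse] using h

/-- The posterior mean is the optimal estimator. -/
lemma mmse_le (hμ : ∀ᵐ y ∂μ, ‖y‖ ≤ 1) (a : ℝ) {f : E → E} (hf : Measurable f)
    (hb : ∀ w, ‖f w‖ ≤ 1) :
    mmse μ a ≤ ∫ p, ‖p.1 - f (a • p.1 + p.2)‖ ^ 2 ∂(μ.prod (stdGaussian E)) := by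
  have hm : Measurable (postMean μ a) := measurable_postMean a
  have hψ : ∀ w, ‖postMean μ a w - f w‖ ≤ 2 := fun w =>
    (norm_sub_le _ _).trans (by linarith [norm_postMean_le hμ a w, hb w])
  have h0 := integral_inner_sub_postMean hμ a (hm.sub hf) hψ
  have hi : Integrable (fun p : E × E => ⟪p.1 - postMean μ a (a • p.1 + p.2),
      (postMean μ a - f) (a • p.1 + p.2)⟫) (μ.prod (stdGaussian E)) := by
    refine integrable_prod_of_bound hμ (C := 4) ?_ fun p hp => ?_
    · exact ((measurable_fst.sub (hm.comp (measurable_channel a))).inner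
        ((hm.sub hf).comp (measurable_channel a))).aestronglyMeasurable
    · refine (norm_inner_le_norm _ _).trans ?_
      have h1 : ‖p.1 - postMean μ a (a • p.1 + p.2)‖ ≤ 2 :=
        (norm_sub_le _ _).trans (by linarith [norm_postMean_le hμ a (a • p.1 + p.2)])
      calc _ ≤ (2 : ℝ) * 2 := mul_le_mul h1 (hψ _) (norm_nonneg _) (by norm_num)
        _ = 4 := by norm_num
  have hA := integrable_norm_sub_sq hμ a hm (norm_postMean_le hμ a)
  -- The cross term has mean zero, so it may be added for free; the comparison then drops the square
  -- of `postMean μ a - f`.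
  calc mmse μ a = ∫ p, (‖p.1 - postMean μ a (a • p.1 + p.2)‖ ^ 2 +
        2 * ⟪p.1 - postMean μ a (a • p.1 + p.2), (postMean μ a - f) (a • p.1 + p.2)⟫)
          ∂(μ.prod (stdGaussian E)) := by
        rw [integral_add hA (hi.const_mul 2), integral_const_mul, h0, mul_zero, add_zero, mmse]
    _ ≤ _ := by
        refine integral_mono (hA.add (hi.const_mul 2)) (integrable_norm_sub_sq hμ a hf hb) ?_
        intro p
        have h1 : p.1 - f (a • p.1 + p.2) = (p.1 - postMean μ a (a • p.1 + p.2)) +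
            (postMean μ a - f) (a • p.1 + p.2) := by simp
        simp only [h1]
        rw [norm_add_sq_real]
        linarith [sq_nonneg ‖(postMean μ a - f) (a • p.1 + p.2)‖]

/-- The mean squared increment of the posterior mean along a chain of degraded observations. -/
lemma integral_norm_postMean_sub_sq (hμ : ∀ᵐ y ∂μ, ‖y‖ ≤ 1) (a : ℝ) {b e : ℝ}
    (h : b ^ 2 + e ^ 2 = 1) :
    ∫ q, ‖postMean μ (b * a) (b • (a • q.1 + q.2.1) + e • q.2.2) -
      postMean μ a (a • q.1 + q.2.1)‖ ^ 2 ∂(μ.prod ((stdGaussian E).prod (stdGaussian E))) =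
      mmse μ (b * a) - mmse μ a := by
  set γ := stdGaussian E
  have hm : ∀ a, Measurable (postMean μ a) := measurable_postMean
  have hn := norm_postMean_le hμ
  have hw : Measurable fun q : E × E × E => a • q.1 + q.2.1 := by fun_prop
  have hw' : Measurable fun q : E × E × E => b • (a • q.1 + q.2.1) + e • q.2.2 := by fun_prop
  -- `A` is the error of the finer estimate, and `A + B` that of the coarser one.
  set A : E × E × E → E := fun q => q.1 - postMean μ a (a • q.1 + q.2.1)
  set B : E × E × E → E := fun q => postMean μ a (a • q.1 + q.2.1) -
    postMean μ (b * a) (b • (a • q.1 + q.2.1) + e • q.2.2)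
  have hAm : Measurable A := measurable_fst.sub ((hm a).comp hw)
  have hBm : Measurable B := ((hm a).comp hw).sub ((hm _).comp hw')
  have hA2 : ∀ q : E × E × E, ‖q.1‖ ≤ 1 → ‖A q‖ ≤ 2 := fun q hq =>
    (norm_sub_le _ _).trans (by linarith [hn a (a • q.1 + q.2.1)])
  have hB2 : ∀ q : E × E × E, ‖B q‖ ≤ 2 := fun q =>
    (norm_sub_le _ _).trans (by
      linarith [hn a (a • q.1 + q.2.1), hn (b * a) (b • (a • q.1 + q.2.1) + e • q.2.2)])
  have iA : Integrable (fun q => ‖A q‖ ^ 2) (μ.prod (γ.prod γ)) := by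
    refine integrable_prod_of_bound hμ (C := 4) (hAm.norm.pow_const 2).aestronglyMeasurable ?_
    intro q hq
    rw [Real.norm_of_nonneg (by positivity)]
    nlinarith [norm_nonneg (A q), hA2 q hq]
  have iB : Integrable (fun q => ‖B q‖ ^ 2) (μ.prod (γ.prod γ)) := by
    refine integrable_prod_of_bound hμ (C := 4) (hBm.norm.pow_const 2).aestronglyMeasurable ?_
    intro q hq
    rw [Real.norm_of_nonneg (by positivity)]
    nlinarith [norm_nonneg (B q), hB2 q]
  have iAB : Integrable (fun q => ⟪A q, B q⟫) (μ.prod (γ.prod γ)) := by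
    refine integrable_prod_of_bound hμ (C := 2 * 2) (hAm.inner hBm).aestronglyMeasurable ?_
    intro q hq
    exact (norm_inner_le_norm _ _).trans
      (mul_le_mul (hA2 q hq) (hB2 q) (norm_nonneg _) (by norm_num))
  have eA : ∫ q, ‖A q‖ ^ 2 ∂(μ.prod (γ.prod γ)) = mmse μ a := by
    have hmp : (μ.prod (γ.prod γ)).map (fun q => (q.1, q.2.1)) = μ.prod γ := by
      have : MeasurePreserving (Prod.map (id : E → E) (Prod.fst : E × E → E))
          (μ.prod (γ.prod γ)) (μ.prod γ) :=
        (MeasurePreserving.id μ).prod measurePreserving_fst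
      exact this.map_eq
    rw [mmse, ← hmp, integral_map (by fun_prop)]
    exact ((measurable_fst.sub ((hm a).comp (measurable_channel a))).norm.pow_const
      2).aestronglyMeasurable
  have eAB' : ∫ q, ‖A q + B q‖ ^ 2 ∂(μ.prod (γ.prod γ)) = mmse μ (b * a) := by
    -- The degraded observation is `(b a) y + (b z + e z')`, whose noise is again standard Gaussian
    -- and independent of `y`.
    have hmp : (μ.prod (γ.prod γ)).map (fun q => (q.1, b • q.2.1 + e • q.2.2)) = μ.prod γ := by
      have : MeasurePreserving (Prod.map (id : E → E) (fun p : E × E => b • p.1 + e • p.2))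
          (μ.prod (γ.prod γ)) (μ.prod γ) :=
        (MeasurePreserving.id μ).prod ⟨by fun_prop, map_smul_add_smul_stdGaussian h⟩
      exact this.map_eq
    rw [mmse, ← hmp, integral_map (by fun_prop)]
    · refine integral_congr_ae (Filter.Eventually.of_forall fun q => ?_)
      simp only [A, B, sub_add_sub_cancel]
      rw [smul_add, mul_smul, add_assoc]
    · exact ((measurable_fst.sub ((hm _).comp (measurable_channel _))).norm.pow_const
        2).aestronglyMeasurable
  have e0 : ∫ q, ⟪A q, B q⟫ ∂(μ.prod (γ.prod γ)) = 0 := by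
    rw [← (measurePreserving_prodAssoc μ γ γ).integral_comp
      (MeasurableEquiv.prodAssoc.measurableEmbedding)]
    have i2 : Integrable (fun p : (E × E) × E => ⟪A (MeasurableEquiv.prodAssoc p),
        B (MeasurableEquiv.prodAssoc p)⟫) ((μ.prod γ).prod γ) :=
      (measurePreserving_prodAssoc μ γ γ).integrable_comp_of_integrable iAB
    rw [integral_prod_symm _ i2]
    -- Once the extra noise `z'` is frozen, `B` is a bounded function of the finer observation
    -- alone, hence orthogonal to `A`.
    refine integral_eq_zero_of_ae (Filter.Eventually.of_forall fun z' => ?_)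
    refine integral_inner_sub_postMean hμ a
      (ψ := fun w => postMean μ a w - postMean μ (b * a) (b • w + e • z')) (C := 2) ?_ ?_
    · exact (hm a).sub ((hm _).comp (by fun_prop))
    · intro w
      exact (norm_sub_le _ _).trans (by linarith [hn a w, hn (b * a) (b • w + e • z')])
  have hexp : ∀ q, ‖A q + B q‖ ^ 2 = ‖A q‖ ^ 2 + 2 * ⟪A q, B q⟫ + ‖B q‖ ^ 2 := fun q =>
    norm_add_sq_real _ _
  simp_rw [hexp] at eAB'
  have iA' : Integrable (fun q => ‖A q‖ ^ 2 + 2 * ⟪A q, B q⟫) (μ.prod (γ.prod γ)) :=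
    iA.add (iAB.const_mul 2)
  rw [integral_add iA' iB, integral_add iA (iAB.const_mul 2),
    integral_const_mul, e0, eA] at eAB'
  have hfin : ∀ q : E × E × E, ‖postMean μ (b * a) (b • (a • q.1 + q.2.1) + e • q.2.2) -
      postMean μ a (a • q.1 + q.2.1)‖ ^ 2 = ‖B q‖ ^ 2 := fun q => by rw [norm_sub_rev]
  simp_rw [hfin]
  linarith

/-- The difference is a mean square by the preceding identity: degrading the observation cannot
help. -/
lemma mmse_le_mmse_mul (hμ : ∀ᵐ y ∂μ, ‖y‖ ≤ 1) (a : ℝ) {b : ℝ} (h : b ^ 2 ≤ 1) :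
    mmse μ a ≤ mmse μ (b * a) := by
  have h1 := integral_norm_postMean_sub_sq hμ a (b := b) (e := Real.sqrt (1 - b ^ 2))
    (by rw [Real.sq_sqrt (by linarith)]; ring)
  have h2 : 0 ≤ mmse μ (b * a) - mmse μ a := by
    rw [← h1]
    exact integral_nonneg fun _ => by positivity
  linarith

end MeanSquaredError

/-! ### Continuity in the gain, and the small-ball bound. -/

section MeanSquaredErrorBounds

variable {E : Type*} [NormedAddCommGroup E] [InnerProductSpace ℝ E] [FiniteDimensional ℝ E]
  [MeasurableSpace E] [BorelSpace E] {μ : Measure E} [IsProbabilityMeasure μ]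

open scoped RealInnerProductSpace

/-- Total variation bound between a standard Gaussian and its translate by `v`. -/
lemma integral_add_stdGaussian_le {g : E → ℝ} (hg : Measurable g) {C δ : ℝ} (hC : ∀ z, |g z| ≤ C)
    {v : E} (hδ : 0 < δ) (hδ1 : δ ≤ 1) (hv : ‖v‖ ≤ δ) :
    ∫ z, g (v + z) ∂stdGaussian E ≤ ∫ z, g z ∂stdGaussian E + 2 * C * δ := by
  set u : E → ℝ := fun z => Real.exp (⟪v, z⟫ - ‖v‖ ^ 2 / 2)
  have hC0 : 0 ≤ C := (abs_nonneg _).trans (hC 0)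
  have hu : ∀ z, u z = Real.exp (-(‖v‖ ^ 2 / 2)) * Real.exp ⟪v, z⟫ := fun z => by
    simp only [u]; rw [← Real.exp_add]; congr 1; ring
  have hu2 : ∀ z, u z ^ 2 = Real.exp (-(‖v‖ ^ 2)) * Real.exp ⟪(2 : ℝ) • v, z⟫ := fun z => by
    simp only [u]
    rw [← Real.exp_nat_mul, ← Real.exp_add, real_inner_smul_left]; congr 1; push_cast; ring
  have iu : Integrable u (stdGaussian E) :=
    ((integrable_exp_inner_stdGaussian v).const_mul _).congr
      (Filter.Eventually.of_forall fun z => (hu z).symm)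
  have iu2 : Integrable (fun z => u z ^ 2) (stdGaussian E) :=
    ((integrable_exp_inner_stdGaussian ((2 : ℝ) • v)).const_mul _).congr
      (Filter.Eventually.of_forall fun z => (hu2 z).symm)
  have eu : ∫ z, u z ∂stdGaussian E = 1 := by
    simp_rw [hu]
    rw [integral_const_mul, integral_exp_inner_stdGaussian, ← Real.exp_add, neg_add_cancel,
      Real.exp_zero]
  have eu2 : ∫ z, u z ^ 2 ∂stdGaussian E = Real.exp (‖v‖ ^ 2) := by
    simp_rw [hu2]
    rw [integral_const_mul, integral_exp_inner_stdGaussian, ← Real.exp_add, norm_smul]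
    congr 1
    rw [mul_pow, Real.norm_eq_abs, sq_abs]; ring
  have iug : Integrable (fun z => u z * g z) (stdGaussian E) :=
    iu.mul_bdd (c := C) hg.aestronglyMeasurable (Filter.Eventually.of_forall hC)
  have ig : Integrable g (stdGaussian E) :=
    Integrable.of_bound hg.aestronglyMeasurable C (Filter.Eventually.of_forall hC)
  have i1 : Integrable (fun z => u z ^ 2 - 2 * u z) (stdGaussian E) := iu2.sub (iu.const_mul 2)
  have i2 : Integrable (fun z => (u z ^ 2 - 2 * u z + 1) / (2 * δ)) (stdGaussian E) :=
    (i1.add (integrable_const 1)).div_const _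
  have iq : Integrable (fun z => C * (δ / 2 + (u z ^ 2 - 2 * u z + 1) / (2 * δ)))
      (stdGaussian E) := ((integrable_const _).add i2).const_mul _
  have hpt : ∀ z, u z * g z ≤ g z + C * (δ / 2 + (u z ^ 2 - 2 * u z + 1) / (2 * δ)) := by
    intro z
    -- This is `2 δ |u - 1| ≤ δ² + (u - 1)²`. It reduces total variation to the second moment of the
    -- density, `E (u - 1)² = exp ‖v‖² - 1 ≤ 2 δ²`.
    have h1 : |u z - 1| ≤ δ / 2 + (u z ^ 2 - 2 * u z + 1) / (2 * δ) := by
      have h2 : δ / 2 + (u z ^ 2 - 2 * u z + 1) / (2 * δ) - |u z - 1| =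
          (δ - |u z - 1|) ^ 2 / (2 * δ) := by
        field_simp
        rw [sub_sq, sq_abs]
        ring
      have : 0 ≤ (δ - |u z - 1|) ^ 2 / (2 * δ) := by positivity
      linarith
    have h3 : (u z - 1) * g z ≤ |u z - 1| * C := by
      refine (le_abs_self _).trans ?_
      rw [abs_mul]
      exact mul_le_mul_of_nonneg_left (hC z) (abs_nonneg _)
    nlinarith
  have hexp : Real.exp (‖v‖ ^ 2) ≤ 1 + 2 * δ ^ 2 := by
    have h1 : ‖v‖ ^ 2 ≤ δ ^ 2 := pow_le_pow_left₀ (norm_nonneg _) hv 2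
    have h2 : ‖v‖ ^ 2 ≤ 1 := by nlinarith
    have h3 := Real.abs_exp_sub_one_sub_id_le (x := ‖v‖ ^ 2)
      (by rw [abs_of_nonneg (by positivity)]; exact h2)
    have h4 := (abs_le.1 h3).2
    nlinarith [sq_nonneg (‖v‖ ^ 2)]
  rw [integral_add_stdGaussian]
  calc ∫ z, u z • g z ∂stdGaussian E
      ≤ ∫ z, (g z + C * (δ / 2 + (u z ^ 2 - 2 * u z + 1) / (2 * δ))) ∂stdGaussian E :=
        integral_mono iug (ig.add iq) hpt
    _ = ∫ z, g z ∂stdGaussian E + C * (δ / 2 + (Real.exp (‖v‖ ^ 2) - 1) / (2 * δ)) := by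
        rw [integral_add ig iq, integral_const_mul, integral_add (integrable_const _) i2,
          integral_div (2 * δ), integral_add i1 (integrable_const _), integral_sub iu2 (iu.const_mul 2),
          integral_const_mul, eu, eu2]
        simp
        left
        ring
    _ ≤ _ := by
        have h1 : (Real.exp (‖v‖ ^ 2) - 1) / (2 * δ) ≤ δ := by
          rw [div_le_iff₀ (by positivity)]
          nlinarith
        nlinarith

/-- The optimal estimator for gain `a` is tried at gain `a'`. The observation law moves by a
translation of length at most `|a' - a|` and the squared error is at most `4`, whence `8 = 2 * 4`.
For `|a' - a| > 1` the bound `mmse ≤ 4` is enough. -/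
lemma mmse_le_mmse_add (hμ : ∀ᵐ y ∂μ, ‖y‖ ≤ 1) (a a' : ℝ) :
    mmse μ a' ≤ mmse μ a + 8 * |a' - a| := by
  rcases eq_or_ne a' a with rfl | hne
  · simp
  rcases le_or_gt |a' - a| 1 with h1 | h1
  swap
  · linarith [mmse_le_four hμ a', mmse_nonneg (μ := μ) a]
  have hδ : 0 < |a' - a| := abs_pos.2 (sub_ne_zero.2 hne)
  have hm : Measurable (postMean μ a) := measurable_postMean a
  have hn := norm_postMean_le hμ a
  refine (mmse_le hμ a' hm hn).trans ?_
  have i1 := integrable_norm_sub_sq hμ a hm hn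
  have i2 := integrable_norm_sub_sq hμ a' hm hn
  rw [mmse, integral_prod _ i1, integral_prod _ i2]
  calc ∫ y, ∫ z, ‖y - postMean μ a (a' • y + z)‖ ^ 2 ∂stdGaussian E ∂μ
      ≤ ∫ y, (∫ z, ‖y - postMean μ a (a • y + z)‖ ^ 2 ∂stdGaussian E + 8 * |a' - a|) ∂μ := by
        refine integral_mono_ae i2.integral_prod_left
          (i1.integral_prod_left.add (integrable_const _)) ?_
        filter_upwards [hμ] with y hy
        have h := integral_add_stdGaussian_le
          (g := fun z => ‖y - postMean μ a (a • y + z)‖ ^ 2) (C := 4) (v := (a' - a) • y) ?_ ?_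
          hδ h1 ?_
        · have e : ∀ z, a • y + ((a' - a) • y + z) = a' • y + z := fun z => by module
          simp_rw [e] at h
          linarith
        · exact (((measurable_const.sub (hm.comp (by fun_prop))).norm).pow_const 2)
        · intro z
          rw [abs_of_nonneg (by positivity)]
          exact norm_sub_sq_le_four hy (hn _)
        · rw [norm_smul, Real.norm_eq_abs]
          exact mul_le_of_le_one_right (abs_nonneg _) hy
    _ = _ := by
        rw [integral_add i1.integral_prod_left (integrable_const _)]
        simp

lemma integral_exp_logLik_stdGaussian (a : ℝ) (y : E) :
    ∫ z, Real.exp (logLik a z y) ∂stdGaussian E = 1 := by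
  have h1 : ∀ z : E, Real.exp (logLik a z y) =
      Real.exp (-(a ^ 2 * ‖y‖ ^ 2 / 2)) * Real.exp ⟪a • y, z⟫ := by
    intro z
    rw [← Real.exp_add, logLik, real_inner_smul_left]
    congr 1; ring
  simp_rw [h1]
  rw [integral_const_mul, integral_exp_inner_stdGaussian, ← Real.exp_add, norm_smul, mul_pow,
    Real.norm_eq_abs, sq_abs, neg_add_cancel, Real.exp_zero]

lemma integral_integral_exp_logLik (a : ℝ) :
    ∫ z, ∫ y, Real.exp (logLik a z y) ∂μ ∂stdGaussian E = 1 := by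
  rw [← integral_integral_swap (integrable_exp_logLik a)]
  simp_rw [integral_exp_logLik_stdGaussian]
  simp

lemma norm_integral_sq_le {ν : Measure E} [IsProbabilityMeasure ν] {u : E → E}
    (hu : Integrable u ν) (hu2 : Integrable (fun y => ‖u y‖ ^ 2) ν) :
    ‖∫ y, u y ∂ν‖ ^ 2 ≤ ∫ y, ‖u y‖ ^ 2 ∂ν := by
  set m := ∫ y, u y ∂ν
  have h1 : ∫ y, ⟪m, u y⟫ ∂ν = ‖m‖ ^ 2 := by
    rw [integral_inner hu, real_inner_self_eq_norm_sq]
  have h2 : ∫ y, 2 * ⟪m, u y⟫ ∂ν ≤ ∫ y, (‖m‖ ^ 2 + ‖u y‖ ^ 2) ∂ν := by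
    refine integral_mono ((hu.const_inner m).const_mul 2) ((integrable_const _).add hu2) fun y => ?_
    have := norm_sub_sq_real m (u y)
    have := sq_nonneg ‖m - u y‖
    simp only
    linarith
  rw [integral_const_mul, h1, integral_add (integrable_const _) hu2] at h2
  simp only [integral_const, probReal_univ, one_smul] at h2
  linarith

lemma exp_integral_le {α : Type*} [MeasurableSpace α] {ν : Measure α} [IsProbabilityMeasure ν]
    {g : α → ℝ} (hg : Integrable g ν) (he : Integrable (fun y => Real.exp (g y)) ν) :
    Real.exp (∫ y, g y ∂ν) ≤ ∫ y, Real.exp (g y) ∂ν := by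
  simpa using convexOn_exp.map_integral_le Real.continuous_exp.continuousOn isClosed_univ
    (Filter.Eventually.of_forall fun _ => Set.mem_univ _) hg he

/-- If every ball of radius `ρ` around a point of the support has mass at least `e^{-Λ}`, then the
minimal mean squared error is of order `Λ / a²`. -/
lemma mmse_le_of_measure_closedBall (hμ : ∀ᵐ y ∂μ, ‖y‖ ≤ 1) (a : ℝ) {ρ Λ : ℝ}
    (hB : ∀ᵐ y ∂μ, Real.exp (-Λ) ≤ μ.real (Metric.closedBall y ρ)) :
    a ^ 2 / 8 * mmse μ a ≤ Λ + a ^ 2 * ρ ^ 2 / 4 := by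
  -- The trial estimator is the mean of the tempered posterior, with the likelihood raised to the
  -- power `1/2`. Tempering leaves room for an explicit exponential moment of `‖y - y₀‖²`, where
  -- `y₀` is the true signal.
  set f : E → E := fun w => ∫ y, y ∂μ.tilted (fun y => logLik a w y / 2)
  have hφc : ∀ w : E, Continuous fun y : E => logLik a w y / 2 := fun w =>
    (continuous_logLik a w continuous_id).div_const 2
  have hf : Measurable f := measurable_integral_tilted (φ := fun w y => logLik a w y / 2)
    ((continuous_uncurry_logLik a).div_const 2)
  have hfb : ∀ w, ‖f w‖ ≤ 1 := fun w => by
    have := isProbabilityMeasure_tilted_of_continuous hμ (hφc w)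
    exact norm_integral_id_le_one (ae_norm_le_tilted hμ _)
  have key : ∀ᵐ y₀ ∂μ, a ^ 2 / 8 * ∫ z, ‖y₀ - f (a • y₀ + z)‖ ^ 2 ∂stdGaussian E ≤
      Λ + a ^ 2 * ρ ^ 2 / 4 := by
    filter_upwards [hμ, hB] with y₀ hy₀ hBy
    set B := Metric.closedBall y₀ ρ
    have hm0 : 0 < μ.real B := (Real.exp_pos _).trans_le hBy
    set N : E → ℝ := fun z => ∫ y, Real.exp (logLik (a / 2) z (y - y₀)) ∂μ
    -- `⟪v, z⟫ - q` is the average over the ball `B` of the tempered log-likelihood, recentred at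
    -- `y₀`.
    set v : E := (μ.real B)⁻¹ • ∫ y in B, (a / 2) • (y - y₀) ∂μ
    set q : ℝ := (μ.real B)⁻¹ * ∫ y in B, a ^ 2 / 4 * ‖y - y₀‖ ^ 2 ∂μ
    have hN : N = fun z => ∫ u, Real.exp (logLik (a / 2) z u) ∂μ.map (fun y => y - y₀) := by
      ext z
      have hc : Continuous fun u : E => Real.exp (logLik (a / 2) z u) :=
        Real.continuous_exp.comp (continuous_logLik _ _ continuous_id)
      rw [integral_map (by fun_prop) hc.aestronglyMeasurable]
    have hp : IsProbabilityMeasure (μ.map (fun y => y - y₀)) :=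
      Measure.isProbabilityMeasure_map (by fun_prop)
    have iN : Integrable N (stdGaussian E) := by
      rw [hN]
      exact (integrable_exp_logLik (μ := μ.map (fun y => y - y₀)) (a / 2)).integral_prod_right
    have eN : ∫ z, N z ∂stdGaussian E = 1 := by
      rw [hN]
      exact integral_integral_exp_logLik (a / 2)
    have hq : q ≤ a ^ 2 * ρ ^ 2 / 4 := by
      have h1 : ∫ y in B, a ^ 2 / 4 * ‖y - y₀‖ ^ 2 ∂μ ≤ ∫ y in B, a ^ 2 / 4 * ρ ^ 2 ∂μ := by
        refine setIntegral_mono_on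
          (integrable_of_continuous_of_ae_norm_le hμ (by fun_prop)).integrableOn
          (integrable_const _).integrableOn measurableSet_closedBall fun y hy => ?_
        have : ‖y - y₀‖ ≤ ρ := by simpa [B, dist_eq_norm] using hy
        gcongr
      rw [setIntegral_const, smul_eq_mul] at h1
      calc q ≤ (μ.real B)⁻¹ * (μ.real B * (a ^ 2 / 4 * ρ ^ 2)) := by
            simp only [q]; gcongr
        _ = _ := by field_simp
    -- Under the Gaussian law of `z`, both `N z - 1` and `⟪v, z⟫` have mean zero, so only `Λ + q`
    -- survives integration.
    have hpt : ∀ z, a ^ 2 / 8 * ‖y₀ - f (a • y₀ + z)‖ ^ 2 ≤ (N z - 1) + (Λ + q) - ⟪v, z⟫ := by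
      intro z
      set ℓ : E → ℝ := fun y => a / 2 * ⟪y - y₀, z⟫ - a ^ 2 / 4 * ‖y - y₀‖ ^ 2
      set k : ℝ := a / 2 * ⟪y₀, z⟫ + a ^ 2 / 4 * ‖y₀‖ ^ 2
      have hφ : ∀ y, logLik a (a • y₀ + z) y / 2 = k + ℓ y := by
        intro y
        simp only [logLik, k, ℓ, inner_add_right, real_inner_smul_right, inner_sub_left,
          norm_sub_sq_real]
        ring
      have hℓc : Continuous ℓ := by fun_prop
      set π := μ.tilted (fun y => logLik a (a • y₀ + z) y / 2)
      have hπ : IsProbabilityMeasure π := isProbabilityMeasure_tilted_of_continuous hμ (hφc _)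
      have hπ1 : ∀ᵐ y ∂π, ‖y‖ ≤ 1 := ae_norm_le_tilted hμ _
      have iu : Integrable (fun y => y - y₀) π :=
        integrable_of_continuous_of_ae_norm_le hπ1 (by fun_prop)
      have iu2 : Integrable (fun y => ‖y - y₀‖ ^ 2) π :=
        integrable_of_continuous_of_ae_norm_le hπ1 (by fun_prop)
      have iid : Integrable (fun y => y) π :=
        integrable_of_continuous_of_ae_norm_le hπ1 (by fun_prop)
      have s1 : ‖y₀ - f (a • y₀ + z)‖ ^ 2 ≤ ∫ y, ‖y - y₀‖ ^ 2 ∂π := by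
        have h1 := norm_integral_sq_le iu iu2
        rw [integral_sub iid (integrable_const _)] at h1
        simp only [integral_const, probReal_univ, one_smul] at h1
        rw [norm_sub_rev]
        exact h1
      have s2 : Real.exp (∫ y, a ^ 2 / 8 * ‖y - y₀‖ ^ 2 ∂π) ≤
          ∫ y, Real.exp (a ^ 2 / 8 * ‖y - y₀‖ ^ 2) ∂π :=
        exp_integral_le (iu2.const_mul _)
          (integrable_of_continuous_of_ae_norm_le hπ1 (by fun_prop))
      set Dz := ∫ y, Real.exp (ℓ y) ∂μ
      have iD : Integrable (fun y => Real.exp (ℓ y)) μ :=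
        integrable_of_continuous_of_ae_norm_le hμ (by fun_prop)
      have hD0 : 0 < Dz := integral_exp_pos iD
      have hN0 : 0 < N z := integral_exp_pos
        (integrable_of_continuous_of_ae_norm_le hμ
          (Real.continuous_exp.comp (continuous_logLik (a / 2) z (by fun_prop))))
      -- Adding `a² ‖u‖² / 8` to `a ⟪u, z⟫ / 2 - a² ‖u‖² / 4`, with `u = y - y₀`, gives the
      -- log-likelihood at gain `a / 2`. The numerator therefore has mean `1` over `z`.
      have s3 : ∫ y, Real.exp (a ^ 2 / 8 * ‖y - y₀‖ ^ 2) ∂π = N z / Dz := by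
        rw [integral_exp_tilted]
        have e1 : ∀ y : E, Real.exp (((fun y => logLik a (a • y₀ + z) y / 2) +
            fun y : E => a ^ 2 / 8 * ‖y - y₀‖ ^ 2 : E → ℝ) y) =
            Real.exp k * Real.exp (logLik (a / 2) z (y - y₀)) := by
          intro y
          rw [Pi.add_apply, hφ, ← Real.exp_add]
          congr 1
          simp only [ℓ, logLik]
          ring
        simp_rw [e1, hφ, Real.exp_add, integral_const_mul]
        rw [mul_div_mul_left _ _ (Real.exp_pos k).ne']
      -- Lower bound for the normalizing constant: restrict to the ball and apply Jensen's
      -- inequality to `μ` conditioned on it.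
      have s4 : Real.exp (⟪v, z⟫ - q) * μ.real B ≤ Dz := by
        have hfin : IsProbabilityMeasure ((μ B)⁻¹ • μ.restrict B) := by
          refine ⟨?_⟩
          rw [Measure.smul_apply, Measure.restrict_apply_univ, smul_eq_mul]
          refine ENNReal.inv_mul_cancel ?_ (measure_ne_top _ _)
          intro h0
          simp [Measure.real, h0] at hm0
        have hiB : ∀ {g : E → ℝ}, Continuous g → IntegrableOn g B μ := fun hg =>
          (integrable_of_continuous_of_ae_norm_le hμ hg).integrableOn
        have hBinv : (μ B)⁻¹ ≠ ⊤ := by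
          refine ENNReal.inv_ne_top.2 fun h0 => ?_
          simp [Measure.real, h0] at hm0
        have h1 := exp_integral_le (ν := (μ B)⁻¹ • μ.restrict B) (g := ℓ)
          ((hiB hℓc).smul_measure hBinv)
          ((hiB (g := fun y => Real.exp (ℓ y)) (by fun_prop)).smul_measure hBinv)
        rw [integral_smul_measure, integral_smul_measure, ENNReal.toReal_inv,
          ← Measure.real] at h1
        have h2 : (μ.real B)⁻¹ • ∫ y in B, ℓ y ∂μ = ⟪v, z⟫ - q := by
          have e1 : ∀ y, ℓ y = ⟪z, (a / 2) • (y - y₀)⟫ - a ^ 2 / 4 * ‖y - y₀‖ ^ 2 := fun y => by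
            rw [real_inner_smul_right, real_inner_comm]
          simp_rw [e1]
          rw [integral_sub ((hiB (g := fun y => ⟪z, (a / 2) • (y - y₀)⟫) (by fun_prop)))
            (hiB (g := fun y => a ^ 2 / 4 * ‖y - y₀‖ ^ 2) (by fun_prop)),
            integral_inner (integrable_of_continuous_of_ae_norm_le (f := fun y => (a / 2) • (y - y₀))
              hμ (by fun_prop)).integrableOn, smul_sub]
          simp only [v, q, smul_eq_mul]
          rw [real_inner_smul_left, real_inner_comm]
        rw [h2, smul_eq_mul] at h1
        have h3 : ∫ y in B, Real.exp (ℓ y) ∂μ ≤ Dz :=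
          setIntegral_le_integral iD (Filter.Eventually.of_forall fun y => (Real.exp_pos _).le)
        calc _ ≤ ((μ.real B)⁻¹ * ∫ y in B, Real.exp (ℓ y) ∂μ) * μ.real B := by gcongr
          _ = ∫ y in B, Real.exp (ℓ y) ∂μ := by field_simp
          _ ≤ Dz := h3
      have s5 : Real.exp (⟪v, z⟫ - q - Λ) ≤ Dz := by
        refine le_trans ?_ s4
        rw [sub_eq_add_neg _ Λ, Real.exp_add]
        gcongr
      have s6 : a ^ 2 / 8 * ‖y₀ - f (a • y₀ + z)‖ ^ 2 ≤ Real.log (N z) - Real.log Dz := by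
        rw [← Real.log_div hN0.ne' hD0.ne', ← s3,
          Real.le_log_iff_exp_le (by rw [s3]; positivity)]
        refine le_trans (Real.exp_le_exp.2 ?_) s2
        rw [integral_const_mul]
        gcongr
      have s7 : ⟪v, z⟫ - q - Λ ≤ Real.log Dz := (Real.le_log_iff_exp_le hD0).2 s5
      have s8 := Real.log_le_sub_one_of_pos hN0
      linarith
    have iL : Integrable (fun z => ‖y₀ - f (a • y₀ + z)‖ ^ 2) (stdGaussian E) := by
      refine Integrable.of_bound (C := 4)
        ((measurable_const.sub (hf.comp (by fun_prop))).norm.pow_const 2).aestronglyMeasurable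
        (Filter.Eventually.of_forall fun z => ?_)
      rw [Real.norm_of_nonneg (by positivity)]
      exact norm_sub_sq_le_four hy₀ (hfb _)
    have i1 : Integrable (fun z => N z - 1) (stdGaussian E) := iN.sub (integrable_const _)
    have i2 : Integrable (fun z => N z - 1 + (Λ + q)) (stdGaussian E) :=
      i1.add (integrable_const _)
    calc a ^ 2 / 8 * ∫ z, ‖y₀ - f (a • y₀ + z)‖ ^ 2 ∂stdGaussian E
        = ∫ z, a ^ 2 / 8 * ‖y₀ - f (a • y₀ + z)‖ ^ 2 ∂stdGaussian E := by
          rw [integral_const_mul]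
      _ ≤ ∫ z, ((N z - 1) + (Λ + q) - ⟪v, z⟫) ∂stdGaussian E :=
          integral_mono (iL.const_mul _) (i2.sub (integrable_inner_stdGaussian v)) hpt
      _ = Λ + q := by
          rw [integral_sub i2 (integrable_inner_stdGaussian v), integral_inner_stdGaussian,
            integral_add i1 (integrable_const _), integral_sub iN (integrable_const _), eN]
          simp
      _ ≤ _ := by linarith
  have i1 := integrable_norm_sub_sq hμ a hf hfb
  calc a ^ 2 / 8 * mmse μ a
      ≤ a ^ 2 / 8 * ∫ p, ‖p.1 - f (a • p.1 + p.2)‖ ^ 2 ∂(μ.prod (stdGaussian E)) := by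
        gcongr
        exact mmse_le hμ a hf hfb
    _ = ∫ y, a ^ 2 / 8 * ∫ z, ‖y - f (a • y + z)‖ ^ 2 ∂stdGaussian E ∂μ := by
        rw [integral_prod _ i1, integral_const_mul]
    _ ≤ ∫ _, (Λ + a ^ 2 * ρ ^ 2 / 4) ∂μ :=
        integral_mono_ae (i1.integral_prod_left.const_mul _) (integrable_const _) key
    _ = _ := by simp

end MeanSquaredErrorBounds

/-! ### The score as a posterior mean, and the error decomposition. -/

section Score

open scoped RealInnerProductSpace

lemma ouSigma_sq {t : ℝ} (ht : 0 ≤ t) : ouSigma t ^ 2 = 1 - Real.exp (-2 * t) :=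
  Real.sq_sqrt (by
    have : Real.exp (-2 * t) ≤ 1 := Real.exp_le_one_iff.2 (by linarith)
    linarith)

lemma ouSigma_pos {t : ℝ} (ht : 0 < t) : 0 < ouSigma t := by
  refine Real.sqrt_pos.2 ?_
  have : Real.exp (-2 * t) < 1 := Real.exp_lt_one_iff.2 (by linarith)
  linarith

lemma ouC_pos (t : ℝ) : 0 < ouC t := Real.exp_pos _

lemma ouC_sq (t : ℝ) : ouC t ^ 2 = Real.exp (-2 * t) := by
  rw [ouC, ← Real.exp_nat_mul]; congr 1; push_cast; ring

variable {D : ℕ} {μ : Measure (Amb D)} [IsProbabilityMeasure μ]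

/-- Expanding the square identifies `σ⁻¹ x` as an observation with gain `c / σ`; the factor free of
`y` disappears from the posterior. -/
lemma exp_neg_norm_sub_sq_eq {c σ : ℝ} (hσ : 0 < σ) (x y : Amb D) :
    Real.exp (-‖x - c • y‖ ^ 2 / (2 * σ ^ 2)) =
      Real.exp (-‖x‖ ^ 2 / (2 * σ ^ 2)) * Real.exp (logLik (c / σ) (σ⁻¹ • x) y) := by
  rw [← Real.exp_add, norm_sub_sq_real, logLik, real_inner_smul_right, real_inner_smul_right,
    norm_smul, mul_pow, Real.norm_eq_abs, sq_abs, real_inner_comm]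
  congr 1
  field_simp
  ring

section Derivative

variable {E : Type*} [NormedAddCommGroup E] [InnerProductSpace ℝ E] [FiniteDimensional ℝ E]
  [MeasurableSpace E] [BorelSpace E]

lemma hasFDerivAt_exp_neg_norm_sub_sq (c σ : ℝ) (x y : E) :
    HasFDerivAt (fun x => Real.exp (-‖x - c • y‖ ^ 2 / (2 * σ ^ 2)))
      (innerSL ℝ (Real.exp (-‖x - c • y‖ ^ 2 / (2 * σ ^ 2)) • (-(σ ^ 2)⁻¹ • (x - c • y)))) x := by
  have h1 : HasFDerivAt (fun x' : E => x' - c • y) (ContinuousLinearMap.id ℝ E) x :=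
    (hasFDerivAt_id x).sub_const _
  have h2 := ((h1.norm_sq.const_mul (-(2 * σ ^ 2)⁻¹))).exp
  have e : ∀ x : E, -‖x - c • y‖ ^ 2 / (2 * σ ^ 2) = -(2 * σ ^ 2)⁻¹ * ‖x - c • y‖ ^ 2 := fun x => by
    rw [neg_div, div_eq_inv_mul, neg_mul]
  simp_rw [e]
  refine h2.congr_fderiv ?_
  ext v
  simp only [smul_apply, ContinuousLinearMap.comp_apply, innerSL_apply_apply,
    real_inner_smul_left, smul_eq_mul, ContinuousLinearMap.id_apply, mul_inv, nsmul_eq_mul]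
  push_cast
  ring

lemma hasFDerivAt_integral_exp_neg_norm_sub_sq {μ : Measure E} [IsProbabilityMeasure μ]
    (hμ : ∀ᵐ y ∂μ, ‖y‖ ≤ 1) (c σ : ℝ) (x : E) :
    HasFDerivAt (fun x => ∫ y, Real.exp (-‖x - c • y‖ ^ 2 / (2 * σ ^ 2)) ∂μ)
      (innerSL ℝ (∫ y, Real.exp (-‖x - c • y‖ ^ 2 / (2 * σ ^ 2)) •
        (-(σ ^ 2)⁻¹ • (x - c • y)) ∂μ)) x := by
  set G : E → E → E := fun x y =>
    Real.exp (-‖x - c • y‖ ^ 2 / (2 * σ ^ 2)) • (-(σ ^ 2)⁻¹ • (x - c • y)) with hG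
  have hGc : Continuous (Function.uncurry G) := by
    simp only [G, Function.uncurry_def]; fun_prop
  -- Domination for differentiating under the integral: the gradient of the kernel is bounded for
  -- `x'` near `x` and `y` in the unit ball.
  obtain ⟨C, hC⟩ := ((isCompact_closedBall x 1).prod
    (isCompact_closedBall (0 : E) 1)).exists_bound_of_continuousOn hGc.continuousOn
  have hint : Integrable (G x) μ :=
    integrable_of_continuous_of_ae_norm_le hμ (hGc.comp (Continuous.prodMk_right x))
  have e : ∫ y, innerSL ℝ (G x y) ∂μ = innerSL ℝ (∫ y, G x y ∂μ) :=
    (innerSL ℝ : E →L[ℝ] _).integral_comp_comm hint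
  have h1 : ∀ x, AEStronglyMeasurable (fun y => Real.exp (-‖x - c • y‖ ^ 2 / (2 * σ ^ 2))) μ :=
    fun x => by
      have : Continuous fun y => Real.exp (-‖x - c • y‖ ^ 2 / (2 * σ ^ 2)) := by fun_prop
      exact this.aestronglyMeasurable
  have h2 : Integrable (fun y => Real.exp (-‖x - c • y‖ ^ 2 / (2 * σ ^ 2))) μ :=
    integrable_of_continuous_of_ae_norm_le hμ (by fun_prop)
  have h3 : AEStronglyMeasurable (fun y => innerSL ℝ (G x y)) μ :=
    ((innerSL ℝ).continuous.comp (hGc.comp (Continuous.prodMk_right x))).aestronglyMeasurable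
  have h4 : ∀ᵐ y ∂μ, ∀ x' ∈ Metric.ball x 1, ‖innerSL ℝ (G x' y)‖ ≤ C := by
    filter_upwards [hμ] with y hy x' hx'
    rw [innerSL_apply_norm]
    exact hC (x', y) ⟨Metric.ball_subset_closedBall hx', by simpa using hy⟩
  rw [← e]
  exact hasFDerivAt_integral_of_dominated_of_fderiv_le (𝕜 := ℝ) (bound := fun _ => C)
    (Metric.ball_mem_nhds x one_pos) (Filter.Eventually.of_forall h1) h2 h3 h4
    (integrable_const _)
    (Filter.Eventually.of_forall fun y x' _ => hasFDerivAt_exp_neg_norm_sub_sq c σ x' y)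

end Derivative

/-- Tweedie's formula. -/
lemma score_eq (hμ : ∀ᵐ y ∂μ, ‖y‖ ≤ 1) {t : ℝ} (ht : 0 < t) (x : Amb D) :
    score μ t x = (ouSigma t ^ 2)⁻¹ •
      (ouC t • postMean μ (ouC t / ouSigma t) ((ouSigma t)⁻¹ • x) - x) := by
  set c := ouC t
  set σ := ouSigma t
  have hσ : 0 < σ := ouSigma_pos ht
  set k : Amb D → ℝ := fun y => Real.exp (-‖x - c • y‖ ^ 2 / (2 * σ ^ 2))
  set K := Real.exp (-‖x‖ ^ 2 / (2 * σ ^ 2))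
  have hkc : Continuous k := by fun_prop
  have ik : Integrable k μ := integrable_of_continuous_of_ae_norm_le hμ hkc
  have iky : Integrable (fun y => k y • y) μ :=
    integrable_of_continuous_of_ae_norm_le hμ (hkc.smul continuous_id)
  have hp : 0 < ∫ y, k y ∂μ := integral_exp_pos ik
  have hfd := (hasFDerivAt_integral_exp_neg_norm_sub_sq hμ c σ x).log hp.ne'
  have hg : HasGradientAt (fun x' => Real.log (marginalDensity μ t x'))
      ((∫ y, k y ∂μ)⁻¹ • ∫ y, k y • (-(σ ^ 2)⁻¹ • (x - c • y)) ∂μ) x := by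
    rw [hasGradientAt_iff_hasFDerivAt]
    refine HasFDerivAt.congr_fderiv (f := fun x' => Real.log (marginalDensity μ t x')) hfd ?_
    ext v
    simp only [smul_apply, innerSL_apply_apply,
      InnerProductSpace.toDual_apply_apply, real_inner_smul_left, smul_eq_mul, k]
  rw [score, hg.gradient]
  have e1 : ∫ y, k y • (-(σ ^ 2)⁻¹ • (x - c • y)) ∂μ =
      (σ ^ 2)⁻¹ • (c • ∫ y, k y • y ∂μ - (∫ y, k y ∂μ) • x) := by
    have e2 : ∀ y, k y • (-(σ ^ 2)⁻¹ • (x - c • y)) =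
        (σ ^ 2)⁻¹ • (c • (k y • y) - k y • x) := fun y => by module
    simp_rw [e2]
    have i1 : Integrable (fun y => c • (k y • y)) μ := iky.smul c
    rw [integral_smul, integral_sub i1 (ik.smul_const x), integral_smul, integral_smul_const]
  have e3 : postMean μ (c / σ) (σ⁻¹ • x) = (∫ y, k y ∂μ)⁻¹ • ∫ y, k y • y ∂μ := by
    have hk : ∀ y, k y = K * Real.exp (logLik (c / σ) (σ⁻¹ • x) y) := fun y =>
      exp_neg_norm_sub_sq_eq hσ x y
    have hK : K ≠ 0 := (Real.exp_pos _).ne'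
    simp_rw [hk, mul_smul]
    rw [integral_const_mul, integral_smul, postMean, integral_tilted, mul_inv, smul_smul,
      mul_right_comm, inv_mul_cancel₀ hK, one_mul, ← integral_smul]
    simp_rw [smul_smul, div_eq_inv_mul]
  rw [e1, e3, smul_comm, smul_sub, smul_smul _ _ x, inv_mul_cancel₀ hp.ne', one_smul, smul_comm c]

/-- The error of the modified score splits into the score approximation error at the grid time and
the increment of the posterior mean. -/
lemma modifiedScore_sub_score (hμ : ∀ᵐ y ∂μ, ‖y‖ ≤ 1) (shat : ℝ → Amb D → Amb D) {r s : ℝ}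
    (hs : 0 < s) (hr : 0 < r) (x x' : Amb D) :
    modifiedScore shat r s x x' - score μ s x =
      ((ouC (r - s))⁻¹ * (ouSigma r ^ 2 / ouSigma s ^ 2)) • (shat r x' - score μ r x') +
      (ouC s / ouSigma s ^ 2) • (postMean μ (ouC r / ouSigma r) ((ouSigma r)⁻¹ • x') -
        postMean μ (ouC s / ouSigma s) ((ouSigma s)⁻¹ • x)) := by
  have hσr := (ouSigma_pos hr).ne'
  have hσs := (ouSigma_pos hs).ne'
  -- This semigroup relation is what makes the terms in `x` and `x'` cancel and gives both posterior
  -- means the same coefficient.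
  have hc : ouC r = ouC (r - s) * ouC s := by
    rw [ouC, ouC, ouC, ← Real.exp_add]; congr 1; ring
  rw [modifiedScore, score_eq hμ hs, score_eq hμ hr]
  generalize postMean μ (ouC r / ouSigma r) ((ouSigma r)⁻¹ • x') = m
  generalize postMean μ (ouC s / ouSigma s) ((ouSigma s)⁻¹ • x) = m'
  rw [hc]
  have hg := (ouC_pos (r - s)).ne'
  have hcs := (ouC_pos s).ne'
  generalize ouC (r - s) = g at *
  generalize ouC s = c at *
  generalize ouSigma r = σ at *
  generalize ouSigma s = τ at *
  match_scalars <;> field_simp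
  all_goals ring

end Score

/-! ### Characteristic functions of sums of Brownian increments. -/

section BrownianIncrements

open scoped RealInnerProductSpace

variable {Ω : Type*} [MeasurableSpace Ω] {P : Measure Ω}

lemma integral_cexp_sum_increments_real [IsProbabilityMeasure P] {b : ℝ≥0 → Ω → ℝ}
    (hb : IsPreBrownianReal b P)
    {τ : ℕ → ℝ≥0} (hτ : Monotone τ) (h : ℕ → ℝ) (n : ℕ) :
    ∫ ω, Complex.exp
      ((∑ j ∈ Finset.range n, h j * (b (τ (j + 1)) ω - b (τ j) ω) : ℝ) * Complex.I) ∂P =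
      Complex.exp ((-(1 / 2) * ∑ j ∈ Finset.range n, h j ^ 2 * ((τ (j + 1) : ℝ) - τ j) : ℝ)) := by
  have hind : iIndepFun (fun (i : Fin n) ω => b (τ (i + 1)) ω - b (τ i) ω) P :=
    (hb.hasIndepIncrements.nat hτ).precomp Fin.val_injective
  have hm : ∀ i : ℕ, AEMeasurable (fun ω => b (τ (i + 1)) ω - b (τ i) ω) P := fun i =>
    (hb.aemeasurable _).sub (hb.aemeasurable _)
  have e1 : ∀ ω, Complex.exp
      ((∑ j ∈ Finset.range n, h j * (b (τ (j + 1)) ω - b (τ j) ω) : ℝ) * Complex.I) =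
      ∏ j : Fin n, Complex.exp (h j * (b (τ (j + 1)) ω - b (τ j) ω : ℝ) * Complex.I) := by
    intro ω
    rw [← Complex.exp_sum, Finset.sum_range, Complex.ofReal_sum, Finset.sum_mul]
    simp only [Complex.ofReal_mul]
  simp_rw [e1]
  rw [hind.integral_fun_prod_comp
    (f := fun (j : Fin n) (x : ℝ) => Complex.exp (h j * (x : ℂ) * Complex.I)) (fun i => hm i)
    (fun i => by
      have : Continuous fun x : ℝ => Complex.exp (h i * (x : ℂ) * Complex.I) := by fun_prop
      exact this.aestronglyMeasurable)]
  rw [Finset.sum_range, Complex.ofReal_mul, Complex.ofReal_sum, Finset.mul_sum, Complex.exp_sum]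
  refine Finset.prod_congr rfl fun j _ => ?_
  obtain ⟨v, hv, hl⟩ : ∃ v : ℝ≥0, (v : ℝ) = (τ (j + 1) : ℝ) - τ j ∧
      HasLaw (b (τ (j + 1)) - b (τ j)) (gaussianReal 0 v) P := by
    refine ⟨_, ?_, hb.hasLaw_sub (τ (j + 1)) (τ j)⟩
    rw [coe_nndist, Real.dist_eq]
    exact abs_of_nonneg (sub_nonneg.2 (NNReal.coe_le_coe.2 (hτ (Nat.le_succ _))))
  have h1 : ∫ ω, Complex.exp (h j * ((b (τ (j + 1)) ω - b (τ j) ω : ℝ) : ℂ) * Complex.I) ∂P =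
      charFun (P.map (b (τ (j + 1)) - b (τ j))) (h j) := by
    rw [charFun_apply_real, integral_map hl.aemeasurable (by fun_prop)]
    rfl
  rw [h1, hl.map_eq, charFun_gaussianReal, ← hv]
  congr 1
  push_cast
  ring

/-- Exchanging the sums over times and coordinates turns the exponential into a product over
independent coordinates, each covered by the real case. -/
lemma integral_cexp_sum_increments {D : ℕ} [IsProbabilityMeasure P] {B : ℝ≥0 → Ω → Amb D}
    (hB : IsBrownianVec B P) {τ : ℕ → ℝ≥0} (hτ : Monotone τ) (h : ℕ → Amb D) (n : ℕ) :
    ∫ ω, Complex.exp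
      ((∑ j ∈ Finset.range n, ⟪h j, B (τ (j + 1)) ω - B (τ j) ω⟫ : ℝ) * Complex.I) ∂P =
      Complex.exp
        ((-(1 / 2) * ∑ j ∈ Finset.range n, ‖h j‖ ^ 2 * ((τ (j + 1) : ℝ) - τ j) : ℝ)) := by
  have e1 : ∀ ω, Complex.exp
      ((∑ j ∈ Finset.range n, ⟪h j, B (τ (j + 1)) ω - B (τ j) ω⟫ : ℝ) * Complex.I) =
      ∏ i : Fin D, Complex.exp ((∑ j ∈ Finset.range n,
        h j i * (B (τ (j + 1)) ω i - B (τ j) ω i) : ℝ) * Complex.I) := by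
    intro ω
    rw [← Complex.exp_sum, ← Finset.sum_mul, ← Complex.ofReal_sum, Finset.sum_comm]
    congr 3
    refine Finset.sum_congr rfl fun j _ => ?_
    rw [PiLp.inner_apply]
    refine Finset.sum_congr rfl fun i _ => ?_
    simp [mul_comm]
  simp_rw [e1]
  rw [hB.indep.integral_fun_prod_comp (f := fun (i : Fin D) (x : ℝ≥0 → ℝ) =>
    Complex.exp ((∑ j ∈ Finset.range n, h j i * (x (τ (j + 1)) - x (τ j)) : ℝ) * Complex.I))]
  · simp_rw [fun i => integral_cexp_sum_increments_real (hB.coord i).toIsPreBrownianReal hτ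
      (fun j => h j i) n]
    rw [← Complex.exp_sum, ← Complex.ofReal_sum, ← Finset.mul_sum, Finset.sum_comm]
    have e2 : ∀ j, ∑ i, h j i ^ 2 * ((τ (j + 1) : ℝ) - τ j) =
        ‖h j‖ ^ 2 * ((τ (j + 1) : ℝ) - τ j) := by
      intro j
      rw [← Finset.sum_mul, EuclideanSpace.norm_sq_eq]
      simp
    simp_rw [e2]
  · intro i
    refine (measurable_pi_lambda _ fun t => ?_).aemeasurable
    have := hB.measurable t
    fun_prop
  · intro i
    refine Measurable.aestronglyMeasurable ?_
    fun_prop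

lemma integral_cexp_initial_add_sum_increments {D : ℕ} [IsProbabilityMeasure P]
    {B : ℝ≥0 → Ω → Amb D} (hB : IsBrownianVec B P) {X₀ : Ω → Amb D} (hX : Measurable X₀)
    (hind : IndepFun X₀ (fun ω (t : ℝ≥0) => B t ω) P)
    {τ : ℕ → ℝ≥0} (hτ : Monotone τ) (ξ : Amb D) (h : ℕ → Amb D) (n : ℕ) :
    ∫ ω, Complex.exp ((⟪X₀ ω, ξ⟫ +
      ∑ j ∈ Finset.range n, ⟪h j, B (τ (j + 1)) ω - B (τ j) ω⟫ : ℝ) * Complex.I) ∂P =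
      charFun (P.map X₀) ξ * Complex.exp
        ((-(1 / 2) * ∑ j ∈ Finset.range n, ‖h j‖ ^ 2 * ((τ (j + 1) : ℝ) - τ j) : ℝ)) := by
  set S : (ℝ≥0 → Amb D) → ℝ := fun x => ∑ j ∈ Finset.range n, ⟪h j, x (τ (j + 1)) - x (τ j)⟫
    with hS
  have hSm : Measurable S :=
    Finset.measurable_sum _ fun j _ => measurable_const.inner
      (Measurable.sub (measurable_pi_apply (τ (j + 1))) (measurable_pi_apply (τ j)))
  have hBm : Measurable (fun ω (t : ℝ≥0) => B t ω) := measurable_pi_lambda _ hB.measurable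
  have hc1 : Continuous fun x : Amb D => Complex.exp (⟪x, ξ⟫ * Complex.I) := by fun_prop
  have hind' : IndepFun (fun ω => Complex.exp (⟪X₀ ω, ξ⟫ * Complex.I))
      (fun ω => Complex.exp (S (fun t => B t ω) * Complex.I)) P :=
    hind.comp (φ := fun x : Amb D => Complex.exp (⟪x, ξ⟫ * Complex.I))
      (ψ := fun x => Complex.exp (S x * Complex.I)) hc1.measurable
      (Complex.measurable_exp.comp ((Complex.measurable_ofReal.comp hSm).mul_const _))
  have hmul := hind'.integral_fun_mul_eq_mul_integral
    (hc1.measurable.comp hX).aestronglyMeasurable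
    (Complex.measurable_exp.comp
      ((Complex.measurable_ofReal.comp (hSm.comp hBm)).mul_const _)).aestronglyMeasurable
  rw [← integral_cexp_sum_increments hB hτ h n, charFun_apply,
    integral_map hX.aemeasurable hc1.aestronglyMeasurable, ← hmul]
  refine integral_congr_ae (Filter.Eventually.of_forall fun ω => ?_)
  simp only [hS]
  rw [← Complex.exp_add, Complex.ofReal_add, add_mul]

end BrownianIncrements

/-! ### Pathwise Riemann sums along solutions of the equation. -/

section RiemannSums

variable {E : Type*} [NormedAddCommGroup E] [NormedSpace ℝ E]

open Filter Topology

/-- Riemann sums with a partially frozen integrand. -/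
lemma tendsto_sum_integral_frozen {F : ℝ → ℝ → E} (hF : Continuous F.uncurry) {u v : ℝ}
    (huv : u ≤ v) {τ : ℕ → ℕ → ℝ} (hτ : ∀ n j, τ n j = u + (v - u) * j / (n + 1)) {ξ : ℕ → ℕ → ℝ}
    (hξ : ∀ n j, ξ n j ∈ Set.Icc (τ n j) (τ n (j + 1))) :
    Tendsto (fun n => ∑ j ∈ Finset.range (n + 1), ∫ t in (τ n j)..(τ n (j + 1)), F (ξ n j) t)
      atTop (𝓝 (∫ t in u..v, F t t)) := by
  have hstep : ∀ n j, τ n (j + 1) - τ n j = (v - u) / (n + 1) := by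
    intro n j; rw [hτ, hτ]; push_cast; ring
  have hmono : ∀ n j, τ n j ≤ τ n (j + 1) := by
    intro n j
    have : 0 ≤ (v - u) / (n + 1 : ℝ) := div_nonneg (by linarith) (by positivity)
    linarith [hstep n j]
  have h0 : ∀ n, τ n 0 = u := fun n => by simp [hτ]
  have hl : ∀ n, τ n (n + 1) = v := fun n => by rw [hτ]; push_cast; field_simp; ring
  have hmem : ∀ n, ∀ j ≤ n + 1, τ n j ∈ Set.Icc u v := by
    intro n j hj
    have hm : Monotone (τ n) := monotone_nat_of_le_succ (hmono n)
    exact ⟨h0 n ▸ hm (Nat.zero_le j), hl n ▸ hm hj⟩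
  have hFd : Continuous fun t => F t t := hF.comp (continuous_id.prodMk continuous_id)
  have hFs : ∀ s, Continuous fun t => F s t := fun s => hF.comp (Continuous.prodMk_right s)
  have huc := ((isCompact_Icc (a := u) (b := v)).prod
    (isCompact_Icc (a := u) (b := v))).uniformContinuousOn_of_continuous hF.continuousOn
  rw [Metric.tendsto_atTop]
  intro ε hε
  -- The `+ 1` keeps the denominator positive when `u = v`.
  set ε' := ε / (v - u + 1)
  have hε' : 0 < ε' := div_pos hε (by linarith)
  obtain ⟨δ, hδ, hδF⟩ := Metric.uniformContinuousOn_iff.1 huc ε' hε'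
  obtain ⟨N, hN⟩ := exists_nat_gt ((v - u) / δ)
  refine ⟨N, fun n hn => ?_⟩
  have hsmall : (v - u) / (n + 1 : ℝ) < δ := by
    rw [div_lt_iff₀ (by positivity)]
    rw [div_lt_iff₀ hδ] at hN
    have : (N : ℝ) ≤ n := by exact_mod_cast hn
    nlinarith
  have hsum : ∫ t in u..v, F t t =
      ∑ j ∈ Finset.range (n + 1), ∫ t in (τ n j)..(τ n (j + 1)), F t t := by
    rw [intervalIntegral.sum_integral_adjacent_intervals, h0, hl]
    exact fun j _ => hFd.intervalIntegrable _ _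
  rw [dist_eq_norm, hsum, ← Finset.sum_sub_distrib]
  have hb : ∀ j ∈ Finset.range (n + 1), ‖(∫ t in (τ n j)..(τ n (j + 1)), F (ξ n j) t) -
      ∫ t in (τ n j)..(τ n (j + 1)), F t t‖ ≤ ε' * ((v - u) / (n + 1)) := by
    intro j hj
    rw [← intervalIntegral.integral_sub ((hFs _).intervalIntegrable _ _)
      (hFd.intervalIntegrable _ _)]
    refine (intervalIntegral.norm_integral_le_of_norm_le_const (C := ε') ?_).trans ?_
    · intro t ht
      rw [Set.uIoc_of_le (hmono n j)] at ht
      have hj' := Finset.mem_range.1 hj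
      have ha := hmem n j (by omega)
      have hb := hmem n (j + 1) (by omega)
      have hξ' := hξ n j
      have ht' : t ∈ Set.Icc u v := ⟨ha.1.trans ht.1.le, ht.2.trans hb.2⟩
      have hξ'' : ξ n j ∈ Set.Icc u v := ⟨ha.1.trans hξ'.1, hξ'.2.trans hb.2⟩
      rw [← dist_eq_norm]
      refine (hδF (ξ n j, t) ⟨hξ'', ht'⟩ (t, t) ⟨ht', ht'⟩ ?_).le
      rw [Prod.dist_eq, dist_self, max_lt_iff]
      refine ⟨?_, hδ⟩
      rw [Real.dist_eq, abs_lt]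
      have := hstep n j
      constructor <;> linarith [hξ'.1, hξ'.2, ht.1, ht.2]
    · rw [hstep, abs_of_nonneg (div_nonneg (by linarith) (by positivity))]
  refine (norm_sum_le_of_le _ hb).trans_lt ?_
  rw [Finset.sum_const, Finset.card_range, nsmul_eq_mul]
  have h1 : ((n + 1 : ℕ) : ℝ) * (ε' * ((v - u) / (n + 1))) = ε' * (v - u) := by
    push_cast; field_simp
  have h2 : ε' * (v - u + 1) = ε := div_mul_cancel₀ _ (by linarith)
  rw [h1]
  linarith

/-- The Riemann-Stieltjes sums of `∫ eᵗ db(t)` along a solution of `x = x₀ - ∫ x + k b`. -/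
lemma tendsto_sum_exp_smul_increments [CompleteSpace E] {x b : ℝ → E} (hx : Continuous x) {x₀ : E}
    {k : ℝ} (hk : k ≠ 0)
    (hb : ∀ t, 0 ≤ t → x t = x₀ - (∫ s in (0 : ℝ)..t, x s) + k • b t) {u v : ℝ} (hu : 0 ≤ u)
    (huv : u ≤ v) {τ : ℕ → ℕ → ℝ} (hτ : ∀ n j, τ n j = u + (v - u) * j / (n + 1)) :
    Tendsto (fun n => ∑ j ∈ Finset.range (n + 1), Real.exp (τ n j) • (b (τ n (j + 1)) - b (τ n j)))
      atTop (𝓝 (k⁻¹ • (Real.exp v • x v - Real.exp u • x u))) := by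
  have hmono : ∀ n j, τ n j ≤ τ n (j + 1) := by
    intro n j
    have h1 : τ n (j + 1) - τ n j = (v - u) / (n + 1) := by rw [hτ, hτ]; push_cast; ring
    have : 0 ≤ (v - u) / (n + 1 : ℝ) := div_nonneg (by linarith) (by positivity)
    linarith
  have h0 : ∀ n, τ n 0 = u := fun n => by simp [hτ]
  have hl : ∀ n, τ n (n + 1) = v := fun n => by rw [hτ]; push_cast; field_simp; ring
  have hnn : ∀ n j, 0 ≤ τ n j := fun n j => by
    have hm : Monotone (τ n) := monotone_nat_of_le_succ (hmono n)
    have := hm (Nat.zero_le j)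
    rw [h0] at this
    linarith
  have hinc : ∀ n j, b (τ n (j + 1)) - b (τ n j) =
      k⁻¹ • (x (τ n (j + 1)) - x (τ n j) + ∫ s in (τ n j)..(τ n (j + 1)), x s) := by
    intro n j
    have hi : ∀ a b, IntervalIntegrable x volume a b := fun a b => hx.intervalIntegrable _ _
    rw [eq_inv_smul_iff₀ hk, smul_sub, ← intervalIntegral.integral_interval_sub_left (hi 0 _)
      (hi 0 _)]
    have h1 := hb _ (hnn n j)
    have h2 := hb _ (hnn n (j + 1))
    rw [h1, h2]
    abel
  -- Discrete integration by parts: the sums equal `k⁻¹` times the telescoping boundary term, minus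
  -- the integrals of `eᵗ x(τ_{j+1})`, plus those of `e^{τ_j} x(t)`. Both families converge to `∫ eᵗ
  -- x(t) dt` and cancel in the limit, so no stochastic integral is needed.
  have hA := tendsto_sum_integral_frozen (F := fun ξ t => Real.exp t • x ξ) (by fun_prop) huv hτ
    (ξ := fun n j => τ n (j + 1)) (fun n j => ⟨hmono n j, le_rfl⟩)
  have hB := tendsto_sum_integral_frozen (F := fun ξ t => Real.exp ξ • x t) (by fun_prop) huv hτ
    (ξ := τ) (fun n j => ⟨le_rfl, hmono n j⟩)
  have hC := (((tendsto_const_nhds (x := Real.exp v • x v - Real.exp u • x u)).sub hA).add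
    hB).const_smul k⁻¹
  rw [sub_add_cancel] at hC
  refine hC.congr fun n => ?_
  simp_rw [hinc, smul_comm _ k⁻¹]
  rw [← Finset.smul_sum]
  congr 1
  have htel : Real.exp v • x v - Real.exp u • x u = ∑ j ∈ Finset.range (n + 1),
      (Real.exp (τ n (j + 1)) • x (τ n (j + 1)) - Real.exp (τ n j) • x (τ n j)) := by
    rw [Finset.sum_range_sub (fun j => Real.exp (τ n j) • x (τ n j)), h0, hl]
  rw [htel, ← Finset.sum_sub_distrib, ← Finset.sum_add_distrib]
  refine Finset.sum_congr rfl fun j _ => ?_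
  rw [intervalIntegral.integral_smul_const, integral_exp, intervalIntegral.integral_smul]
  module

end RiemannSums

/-! ### Characteristic function of the rescaled process increments. -/

section ForwardProcess

open scoped RealInnerProductSpace
open Filter Topology

lemma tendsto_sum_exp_sq_increments {u v : ℝ} (huv : u ≤ v) {τ : ℕ → ℕ → ℝ}
    (hτ : ∀ n j, τ n j = u + (v - u) * j / (n + 1)) :
    Tendsto (fun n => ∑ j ∈ Finset.range (n + 1),
      Real.exp (τ n j) ^ 2 * (τ n (j + 1) - τ n j)) atTop
      (𝓝 ((Real.exp (2 * v) - Real.exp (2 * u)) / 2)) := by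
  have hmono : ∀ n j, τ n j ≤ τ n (j + 1) := by
    intro n j
    have h1 : τ n (j + 1) - τ n j = (v - u) / (n + 1) := by rw [hτ, hτ]; push_cast; ring
    have : 0 ≤ (v - u) / (n + 1 : ℝ) := div_nonneg (by linarith) (by positivity)
    linarith
  have h := tendsto_sum_integral_frozen (F := fun ξ _ => Real.exp ξ ^ 2) (by fun_prop) huv hτ
    (ξ := τ) (fun n j => ⟨le_rfl, hmono n j⟩)
  have e : ∫ t in u..v, Real.exp t ^ 2 = (Real.exp (2 * v) - Real.exp (2 * u)) / 2 := by
    have h1 : ∀ t, Real.exp t ^ 2 = Real.exp (2 * t) := fun t => by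
      rw [← Real.exp_nat_mul]; norm_num
    simp_rw [h1]
    rw [intervalIntegral.integral_comp_mul_left (fun t => Real.exp t) two_ne_zero, integral_exp,
      smul_eq_mul]
    ring
  rw [e] at h
  refine h.congr fun n => Finset.sum_congr rfl fun j _ => ?_
  rw [intervalIntegral.integral_const, smul_eq_mul, mul_comm]

variable {D : ℕ} {Ω : Type*} [MeasurableSpace Ω] {P : Measure Ω} [IsProbabilityMeasure P]
  {μ : Measure (Amb D)} {X : ℝ≥0 → Ω → Amb D}

/-- A partition of `[0, s]` into `n + 1` equal intervals, followed by one of `[s, s + δ]`. -/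
noncomputable def twoStepGrid (s δ : ℝ≥0) (n j : ℕ) : ℝ≥0 :=
  s * (min j (n + 1) : ℕ) / (n + 1) + δ * (j - (n + 1) : ℕ) / (n + 1)

lemma monotone_twoStepGrid (s δ : ℝ≥0) (n : ℕ) : Monotone (twoStepGrid s δ n) := by
  intro i j hij
  unfold twoStepGrid
  gcongr

lemma twoStepGrid_of_le (s δ : ℝ≥0) {n j : ℕ} (hj : j ≤ n + 1) :
    (twoStepGrid s δ n j : ℝ) = 0 + ((s : ℝ) - 0) * j / (n + 1) := by
  simp [twoStepGrid, min_eq_left hj, Nat.sub_eq_zero_of_le hj]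

lemma twoStepGrid_add (s δ : ℝ≥0) (n j : ℕ) :
    (twoStepGrid s δ n (n + 1 + j) : ℝ) = s + (((s + δ : ℝ≥0) : ℝ) - s) * j / (n + 1) := by
  have : min (n + 1 + j) (n + 1) = n + 1 := min_eq_right (by omega)
  rw [twoStepGrid, this, Nat.add_sub_cancel_left]
  push_cast
  field_simp
  ring

/-- The increments of `eᵗ X(t) / √2` are limits of sums of `e^{τ_j} (B(τ_{j+1}) - B(τ_j))`. For
these sums the characteristic function is explicit, and dominated convergence passes to the limit
because the integrands have modulus `1`. -/
lemma IsForwardProcess.integral_cexp (hX : IsForwardProcess μ X P) (s δ : ℝ≥0)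
    (ξ η ζ : Amb D) :
    ∫ ω, Complex.exp ((⟪X 0 ω, ξ⟫ +
      (⟪η, (Real.sqrt 2)⁻¹ • (Real.exp s • X s ω - X 0 ω)⟫ +
        ⟪ζ, (Real.sqrt 2)⁻¹ • (Real.exp (s + δ : ℝ≥0) • X (s + δ) ω - Real.exp s • X s ω)⟫) : ℝ) *
          Complex.I) ∂P =
      charFun μ ξ * Complex.exp ((-(1 / 2) * (‖η‖ ^ 2 * ((Real.exp (2 * s) - 1) / 2) +
        ‖ζ‖ ^ 2 * ((Real.exp (2 * (s + δ : ℝ≥0)) - Real.exp (2 * s)) / 2)) : ℝ)) := by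
  obtain ⟨B, hB, hind, hsde⟩ := hX.sde
  set τ := twoStepGrid s δ
  -- A single grid with weight `η` on `[0, s]` and `ζ` on `[s, s + δ]` handles both increments, and
  -- their independence, at once.
  set h : ℕ → ℕ → Amb D := fun n j => Real.exp (τ n j) • (if j < n + 1 then η else ζ)
  have h1 : ∀ n, ∀ j ∈ Finset.range (n + 1), h n j = Real.exp (τ n j) • η := fun n j hj => by
    simp only [h, if_pos (Finset.mem_range.1 hj)]
  have h2 : ∀ n j, h n (n + 1 + j) = Real.exp (τ n (n + 1 + j)) • ζ := fun n j => by
    simp only [h, if_neg (show ¬ n + 1 + j < n + 1 by omega)]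
  have hτ1 : ∀ n, ∀ j ∈ Finset.range (n + 1), (τ n j : ℝ) = 0 + ((s : ℝ) - 0) * j / (n + 1) ∧
      (τ n (j + 1) : ℝ) = 0 + ((s : ℝ) - 0) * (j + 1 : ℕ) / (n + 1) := fun n j hj =>
    ⟨twoStepGrid_of_le s δ (by have := Finset.mem_range.1 hj; omega),
      twoStepGrid_of_le s δ (by have := Finset.mem_range.1 hj; omega)⟩
  have hcf := fun n => integral_cexp_initial_add_sum_increments hB (hX.measurable 0) hind
    (monotone_twoStepGrid s δ n) ξ (h n) (n + 1 + (n + 1))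
  rw [hX.law_zero] at hcf
  have hs0 : (0 : ℝ) ≤ s := s.2
  have hsδ : (s : ℝ) ≤ (s + δ : ℝ≥0) := by push_cast; linarith [δ.2]
  refine tendsto_nhds_unique (f := fun n => ∫ ω, Complex.exp ((⟪X 0 ω, ξ⟫ +
      ∑ j ∈ Finset.range (n + 1 + (n + 1)), ⟪h n j, B (τ n (j + 1)) ω - B (τ n j) ω⟫ : ℝ) *
        Complex.I) ∂P) (l := atTop) ?_ ?_
  · refine tendsto_integral_of_dominated_convergence (fun _ => 1) ?_ (integrable_const _) ?_ ?_
    · intro n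
      have hm : Measurable fun ω => ⟪X 0 ω, ξ⟫ + ∑ j ∈ Finset.range (n + 1 + (n + 1)),
          ⟪h n j, B (τ n (j + 1)) ω - B (τ n j) ω⟫ :=
        ((hX.measurable 0).inner measurable_const).add (Finset.measurable_sum _ fun j _ =>
          measurable_const.inner ((hB.measurable _).sub (hB.measurable _)))
      exact (Complex.measurable_exp.comp
        ((Complex.measurable_ofReal.comp hm).mul_const _)).aestronglyMeasurable
    · intro n
      filter_upwards with ω
      rw [Complex.norm_exp_ofReal_mul_I]
    · filter_upwards [hsde] with ω hω
      obtain ⟨hc, hω⟩ := hω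
      have hcx : Continuous fun t : ℝ => X t.toNNReal ω := hc.comp continuous_real_toNNReal
      have hb : ∀ t : ℝ, 0 ≤ t → X t.toNNReal ω =
          X 0 ω - (∫ s in (0 : ℝ)..t, X s.toNNReal ω) + Real.sqrt 2 • B t.toNNReal ω := by
        intro t ht
        have := hω t.toNNReal
        rwa [Real.coe_toNNReal t ht] at this
      have hk : Real.sqrt 2 ≠ 0 := by positivity
      have t1 := tendsto_sum_exp_smul_increments hcx hk hb le_rfl hs0
        (τ := fun n j => 0 + ((s : ℝ) - 0) * j / (n + 1)) (fun n j => rfl)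
      have t2 := tendsto_sum_exp_smul_increments hcx hk hb hs0 hsδ
        (τ := fun n j => s + (((s + δ : ℝ≥0) : ℝ) - s) * j / (n + 1)) (fun n j => rfl)
      simp only [Real.toNNReal_coe, Real.exp_zero, Real.toNNReal_zero, one_smul] at t1 t2
      have t3 := (((tendsto_const_nhds (x := η)).inner t1).add
        ((tendsto_const_nhds (x := ζ)).inner t2)).const_add ⟪X 0 ω, ξ⟫
      have t4 := ((Complex.continuous_ofReal.tendsto _).comp t3).mul_const Complex.I
      refine ((Complex.continuous_exp.tendsto _).comp t4).congr fun n => ?_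
      simp only [Function.comp_apply]
      congr 4
      rw [inner_sum, inner_sum, Finset.sum_range_add _ (n + 1) (n + 1)]
      congr 1
      · refine Finset.sum_congr rfl fun j hj => ?_
        rw [h1 n j hj, real_inner_smul_left, real_inner_smul_right, ← (hτ1 n j hj).1,
          ← (hτ1 n j hj).2, Real.toNNReal_coe, Real.toNNReal_coe]
      · refine Finset.sum_congr rfl fun j _ => ?_
        rw [h2 n j, real_inner_smul_left, real_inner_smul_right, ← twoStepGrid_add,
          ← twoStepGrid_add, Real.toNNReal_coe, Real.toNNReal_coe]
        rfl
  · refine Tendsto.congr (fun n => (hcf n).symm) ?_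
    refine Tendsto.const_mul _ ((Complex.continuous_exp.tendsto _).comp
      ((Complex.continuous_ofReal.tendsto _).comp (Tendsto.const_mul _ ?_)))
    have t1 := (tendsto_sum_exp_sq_increments hs0
      (τ := fun n j => 0 + ((s : ℝ) - 0) * j / (n + 1)) (fun n j => rfl)).const_mul (‖η‖ ^ 2)
    have t2 := (tendsto_sum_exp_sq_increments hsδ
      (τ := fun n j => s + (((s + δ : ℝ≥0) : ℝ) - s) * j / (n + 1))
      (fun n j => rfl)).const_mul (‖ζ‖ ^ 2)
    simp only [mul_zero, Real.exp_zero] at t1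
    refine (t1.add t2).congr fun n => ?_
    rw [Finset.mul_sum, Finset.mul_sum, Finset.sum_range_add _ (n + 1) (n + 1)]
    congr 1
    · refine Finset.sum_congr rfl fun j hj => ?_
      rw [h1 n j hj, norm_smul, mul_pow, Real.norm_eq_abs, sq_abs, ← (hτ1 n j hj).1,
        ← (hτ1 n j hj).2]
      ring
    · refine Finset.sum_congr rfl fun j _ => ?_
      rw [h2 n j, norm_smul, mul_pow, Real.norm_eq_abs, sq_abs, ← twoStepGrid_add,
        ← twoStepGrid_add]
      simp only [τ, add_assoc]
      ring

end ForwardProcess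

/-! ### Joint law of the forward process at two times. -/

section ForwardLaw

open scoped RealInnerProductSpace

lemma exists_inner_eq_of_dual_prod {E : Type*} [NormedAddCommGroup E] [InnerProductSpace ℝ E]
    [CompleteSpace E] (L : StrongDual ℝ (E × E × E)) :
    ∃ ξ η ζ : E, ∀ q, L q = ⟪q.1, ξ⟫ + (⟪η, q.2.1⟫ + ⟪ζ, q.2.2⟫) := by
  refine ⟨(InnerProductSpace.toDual ℝ E).symm (L.comp (.inl ℝ E (E × E))),
    (InnerProductSpace.toDual ℝ E).symm (L.comp ((ContinuousLinearMap.inr ℝ E (E × E)).comp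
      (.inl ℝ E E))),
    (InnerProductSpace.toDual ℝ E).symm (L.comp ((ContinuousLinearMap.inr ℝ E (E × E)).comp
      (.inr ℝ E E))), fun q => ?_⟩
  rw [real_inner_comm]
  simp only [InnerProductSpace.toDual_symm_apply, ContinuousLinearMap.comp_apply,
    ContinuousLinearMap.inl_apply, ContinuousLinearMap.inr_apply]
  rw [← map_add, ← map_add]
  simp

lemma charFunDual_map_prod_stdGaussian {E : Type*} [NormedAddCommGroup E] [InnerProductSpace ℝ E]
    [FiniteDimensional ℝ E] [MeasurableSpace E] [BorelSpace E] {μ : Measure E}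
    [IsProbabilityMeasure μ] (a b : ℝ) (ξ η ζ : E) :
    ∫ q, Complex.exp ((⟪q.1, ξ⟫ + (⟪η, a • q.2.1⟫ + ⟪ζ, b • q.2.2⟫) : ℝ) * Complex.I)
      ∂(μ.prod ((stdGaussian E).prod (stdGaussian E))) =
    charFun μ ξ * Complex.exp ((-(1 / 2) * (‖η‖ ^ 2 * a ^ 2 + ‖ζ‖ ^ 2 * b ^ 2) : ℝ)) := by
  have e : ∀ q : E × E × E,
      Complex.exp ((⟪q.1, ξ⟫ + (⟪η, a • q.2.1⟫ + ⟪ζ, b • q.2.2⟫) : ℝ) * Complex.I) =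
      Complex.exp (⟪q.1, ξ⟫ * Complex.I) * (Complex.exp (⟪q.2.1, a • η⟫ * Complex.I) *
        Complex.exp (⟪q.2.2, b • ζ⟫ * Complex.I)) := by
    intro q
    rw [← Complex.exp_add, ← Complex.exp_add]
    congr 1
    simp only [real_inner_smul_right, real_inner_comm]
    push_cast
    ring
  simp_rw [e]
  rw [integral_prod_mul (fun x : E => Complex.exp (⟪x, ξ⟫ * Complex.I))
    (fun p : E × E => Complex.exp (⟪p.1, a • η⟫ * Complex.I) *
        Complex.exp (⟪p.2, b • ζ⟫ * Complex.I)),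
    integral_prod_mul (fun x : E => Complex.exp (⟪x, a • η⟫ * Complex.I))
      (fun x : E => Complex.exp (⟪x, b • ζ⟫ * Complex.I)), ← charFun_apply, ← charFun_apply,
    ← charFun_apply, charFun_stdGaussian, charFun_stdGaussian, ← Complex.exp_add]
  congr 2
  rw [norm_smul, norm_smul, ← Complex.ofReal_pow, ← Complex.ofReal_pow, mul_pow, mul_pow,
    Real.norm_eq_abs, Real.norm_eq_abs, sq_abs, sq_abs]
  push_cast
  ring

variable {D : ℕ} {Ω : Type*} [MeasurableSpace Ω] {P : Measure Ω} [IsProbabilityMeasure P]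
  {μ : Measure (Amb D)} [IsProbabilityMeasure μ] {X : ℝ≥0 → Ω → Amb D}

lemma IsForwardProcess.map_increments (hX : IsForwardProcess μ X P) (s δ : ℝ≥0) :
    P.map (fun ω => (X 0 ω, (Real.sqrt 2)⁻¹ • (Real.exp s • X s ω - X 0 ω),
      (Real.sqrt 2)⁻¹ • (Real.exp (s + δ : ℝ≥0) • X (s + δ) ω - Real.exp s • X s ω))) =
    (μ.prod ((stdGaussian (Amb D)).prod (stdGaussian (Amb D)))).map (fun q =>
      (q.1, Real.sqrt ((Real.exp (2 * s) - 1) / 2) • q.2.1,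
        Real.sqrt ((Real.exp (2 * (s + δ : ℝ≥0)) - Real.exp (2 * s)) / 2) • q.2.2)) := by
  have hm : Measurable (fun ω => (X 0 ω, (Real.sqrt 2)⁻¹ • (Real.exp s • X s ω - X 0 ω),
      (Real.sqrt 2)⁻¹ • (Real.exp (s + δ : ℝ≥0) • X (s + δ) ω - Real.exp s • X s ω))) := by
    have h0 := hX.measurable 0
    have h1 := hX.measurable s
    have h2 := hX.measurable (s + δ)
    fun_prop
  have := Measure.isProbabilityMeasure_map (μ := P) hm.aemeasurable
  have : IsProbabilityMeasure ((μ.prod ((stdGaussian (Amb D)).prod (stdGaussian (Amb D)))).map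
      (fun q => (q.1, Real.sqrt ((Real.exp (2 * s) - 1) / 2) • q.2.1,
        Real.sqrt ((Real.exp (2 * (s + δ : ℝ≥0)) - Real.exp (2 * s)) / 2) • q.2.2))) :=
    Measure.isProbabilityMeasure_map (by fun_prop)
  -- The product carries the sup norm and is not an inner product space, so characteristic functions
  -- on its dual are used.
  refine Measure.ext_of_charFunDual (funext fun L => ?_)
  obtain ⟨ξ, η, ζ, hL⟩ := exists_inner_eq_of_dual_prod L
  have hLc : Continuous fun q => Complex.exp (L q * Complex.I) := by fun_prop
  rw [charFunDual_apply, charFunDual_apply, integral_map hm.aemeasurable hLc.aestronglyMeasurable,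
    integral_map (by fun_prop) hLc.aestronglyMeasurable]
  simp_rw [hL]
  rw [hX.integral_cexp, charFunDual_map_prod_stdGaussian, Real.sq_sqrt, Real.sq_sqrt]
  · have : Real.exp (2 * s) ≤ Real.exp (2 * (s + δ : ℝ≥0)) := by
      refine Real.exp_le_exp.2 ?_
      push_cast
      linarith [δ.2]
    linarith
  · have : 1 ≤ Real.exp (2 * s) := Real.one_le_exp (by positivity)
    linarith

/-- Converts the variance of `√2 ∫ eᵗ dB` over `[u, v]`, rescaled by `e^{-v}`, into the noise level
of the transition from `u` to `v`. -/
lemma exp_neg_mul_sqrt {u v : ℝ} (h : u ≤ v) :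
    Real.exp (-v) * (Real.sqrt 2 * Real.sqrt ((Real.exp (2 * v) - Real.exp (2 * u)) / 2)) =
      ouSigma (v - u) := by
  have h0 : Real.exp (-v) = Real.sqrt (Real.exp (-v) ^ 2) :=
    (Real.sqrt_sq (Real.exp_pos _).le).symm
  have h1 : Real.exp (2 * u) ≤ Real.exp (2 * v) := Real.exp_le_exp.2 (by linarith)
  rw [h0, ← Real.sqrt_mul (by norm_num), ← Real.sqrt_mul (by positivity), ouSigma]
  congr 1
  rw [← Real.exp_nat_mul, mul_div_cancel₀ _ two_ne_zero, mul_sub, ← Real.exp_add, ← Real.exp_add]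
  push_cast
  rw [show 2 * -v + 2 * v = 0 by ring, Real.exp_zero,
    show 2 * -v + 2 * u = -2 * (v - u) by ring]

/-- The joint law of the forward process at two times. -/
lemma IsForwardProcess.map_pair (hX : IsForwardProcess μ X P) {s r : ℝ} (hs : 0 ≤ s)
    (hsr : s ≤ r) :
    P.map (fun ω => (X s.toNNReal ω, X r.toNNReal ω)) =
      (μ.prod ((stdGaussian (Amb D)).prod (stdGaussian (Amb D)))).map (fun q =>
        (ouC s • q.1 + ouSigma s • q.2.1,
          ouC (r - s) • (ouC s • q.1 + ouSigma s • q.2.1) + ouSigma (r - s) • q.2.2)) := by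
  lift s to ℝ≥0 using hs
  obtain ⟨δ, hδ⟩ : ∃ δ : ℝ≥0, r = (s + δ : ℝ≥0) :=
    ⟨(r - s).toNNReal, by rw [NNReal.coe_add, Real.coe_toNNReal _ (by linarith)]; ring⟩
  subst hδ
  rw [Real.toNNReal_coe, Real.toNNReal_coe]
  have hinc := hX.map_increments s δ
  -- `G` rebuilds `(X(s), X(s + δ))` from the initial point and the two increments.
  set G : Amb D × Amb D × Amb D → Amb D × Amb D := fun q =>
    (Real.exp (-s) • (q.1 + Real.sqrt 2 • q.2.1),
      Real.exp (-(s + δ : ℝ≥0)) • (q.1 + Real.sqrt 2 • q.2.1 + Real.sqrt 2 • q.2.2))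
  have hG : Measurable G := by fun_prop
  have h := congrArg (Measure.map G) hinc
  have h2 : Real.sqrt 2 ≠ 0 := by positivity
  have h0 := hX.measurable 0
  have h1 := hX.measurable s
  have h1' := hX.measurable (s + δ)
  rw [Measure.map_map hG (by fun_prop), Measure.map_map hG (by fun_prop)] at h
  convert h using 2
  · ext1 ω
    simp only [Function.comp_apply, G, smul_inv_smul₀ h2, add_sub_cancel, smul_smul]
    rw [← Real.exp_add, ← Real.exp_add, neg_add_cancel, neg_add_cancel, Real.exp_zero, one_smul,
      one_smul]
  · ext1 q
    have e1 := exp_neg_mul_sqrt (u := 0) (v := s) s.2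
    have e2 := exp_neg_mul_sqrt (u := s) (v := (s + δ : ℝ≥0)) (by push_cast; linarith [δ.2])
    rw [mul_zero, Real.exp_zero, sub_zero] at e1
    have e3 : Real.exp (-((s + δ : ℝ≥0) : ℝ)) =
        Real.exp (-(((s + δ : ℝ≥0) : ℝ) - s)) * Real.exp (-s) := by
      rw [← Real.exp_add]; congr 1; ring
    simp only [Function.comp_apply, G, ouC]
    rw [← e1, ← e2]
    refine Prod.ext ?_ ?_
    · simp only [smul_add, smul_smul]
    · simp only [smul_add, smul_smul, mul_assoc, e3]

end ForwardLaw

/-! ### Lower bounds for the mass of small balls. -/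

section SmallBalls

/-- Crude form of the volume formula, from `Γ(d/2 + 1) ≤ d! ≤ d^d` and `π ≥ 1`; the loss costs only
`d log d` in the exponent, which `Clog²` absorbs. -/
lemma pow_div_pow_le_volume_ball {V : Type*} [NormedAddCommGroup V] [InnerProductSpace ℝ V]
    [FiniteDimensional ℝ V] [MeasurableSpace V] [BorelSpace V] {d : ℕ} (hd : 2 ≤ d)
    (hV : Module.finrank ℝ V = d) {R : ℝ} (hR : 0 ≤ R) :
    ENNReal.ofReal ((R / d) ^ d) ≤ volume (Metric.ball (0 : V) R) := by
  have : Nontrivial V := Module.nontrivial_of_finrank_pos (R := ℝ) (by omega)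
  rw [InnerProductSpace.volume_ball, hV, ← ENNReal.ofReal_pow hR,
    ← ENNReal.ofReal_mul (by positivity), div_pow]
  refine ENNReal.ofReal_le_ofReal ?_
  rw [div_eq_mul_one_div]
  have hd' : (2 : ℝ) ≤ d := by exact_mod_cast hd
  have hG : Real.Gamma ((d : ℝ) / 2 + 1) ≤ (d : ℝ) ^ d := by
    have h1 : Real.Gamma ((d : ℝ) / 2 + 1) ≤ Real.Gamma ((d : ℝ) + 1) :=
      Real.Gamma_strictMonoOn_Ici.monotoneOn (Set.mem_Ici.2 (by linarith))
        (Set.mem_Ici.2 (by linarith)) (by linarith)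
    rw [Real.Gamma_nat_eq_factorial] at h1
    refine h1.trans ?_
    exact_mod_cast Nat.factorial_le_pow d
  have hG0 : 0 < Real.Gamma ((d : ℝ) / 2 + 1) := Real.Gamma_pos_of_pos (by positivity)
  have hπ : 1 ≤ Real.sqrt Real.pi ^ d := by
    refine one_le_pow₀ ?_
    rw [Real.one_le_sqrt]
    linarith [Real.pi_gt_three]
  gcongr

/-- The derivative bound makes `Φ_y` send the tangent ball of radius `R` into the ball of radius `ρ`
about `y`. Hence the projection of that piece of `M` covers the tangent ball, and a `1`-Lipschitz
map does not increase Hausdorff measure. -/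
lemma IsRegularManifold.le_hausdorffMeasure_closedBall {D d β : ℕ} {M : Set (Amb D)} {τ LM : ℝ}
    (hM : IsRegularManifold d β M τ LM) (hβ : 1 ≤ β) {y : Amb D} (hy : y ∈ M) {ρ R : ℝ}
    (hR : 0 ≤ R) (hRτ : R ≤ τ / 8) (hRρ : LM * R ≤ ρ) :
    ENNReal.ofReal ((R / d) ^ d) ≤ μHE[d] (Metric.closedBall y ρ ∩ M) := by
  obtain ⟨Φ, hΦ, hC⟩ := hM.charts y hy
  have hfr : Module.finrank ℝ (tangentSubspace M y) = d := hM.finrank_tangent y hy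
  have hτ := hM.reach_pos
  have hsub : Metric.ball (0 : tangentSubspace M y) R ⊆ Metric.ball 0 (τ / 8) := Metric.ball_subset_ball hRτ
  have h0mem : (0 : tangentSubspace M y) ∈ Metric.ball (0 : tangentSubspace M y) (τ / 8) := Metric.mem_ball_self (by positivity)
  have hΦ0 : Φ 0 = y := by
    refine hΦ.injOn (hΦ.mapsTo 0 h0mem) ⟨hy, Metric.mem_ball_self (by positivity)⟩ ?_
    rw [hΦ.rightInv 0 h0mem, tangentProj, sub_self, map_zero]
  have hdiff : ∀ z ∈ Metric.ball (0 : tangentSubspace M y) (τ / 8), DifferentiableAt ℝ Φ z := fun z hz =>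
    ((hC.contDiffOn.contDiffAt (Metric.isOpen_ball.mem_nhds hz)).differentiableAt
      (by exact_mod_cast (by omega : β ≠ 0)))
  have hLip : ∀ z ∈ Metric.ball (0 : tangentSubspace M y) R, dist (Φ z) y ≤ ρ := by
    intro z hz
    have h1 := (convex_ball (0 : tangentSubspace M y) (τ / 8)).norm_image_sub_le_of_norm_fderiv_le hdiff
      (fun w hw => by rw [← norm_iteratedFDeriv_one]; exact hC.norm_le 1 hβ w hw) h0mem
      (hsub hz)
    rw [hΦ0, ← dist_eq_norm, sub_zero] at h1
    have h2 : ‖z‖ ≤ R := by simpa using (Metric.mem_ball.1 hz).le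
    exact h1.trans ((mul_le_mul_of_nonneg_left h2 hM.const_pos.le).trans hRρ)
  have himg : Metric.ball (0 : tangentSubspace M y) R ⊆ tangentProj M y '' (Metric.closedBall y ρ ∩ M) := by
    intro z hz
    exact ⟨Φ z, ⟨hLip z hz, (hΦ.mapsTo z (hsub hz)).1⟩, hΦ.rightInv z (hsub hz)⟩
  have hproj : LipschitzWith 1 (tangentProj M y) := by
    refine LipschitzWith.of_dist_le_mul fun a b => ?_
    rw [tangentProj, tangentProj, dist_eq_norm, ← map_sub, sub_sub_sub_cancel_right,
      NNReal.coe_one, one_mul, dist_eq_norm]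
    exact Submodule.norm_orthogonalProjectionOnto_apply_le _ _
  calc ENNReal.ofReal ((R / d) ^ d) ≤ volume (Metric.ball (0 : tangentSubspace M y) R) :=
        pow_div_pow_le_volume_ball (by linarith [hM.three_le]) hfr hR
    _ = μHE[d] (Metric.ball (0 : tangentSubspace M y) R) := by
        rw [← InnerProductSpace.euclideanHausdorffMeasure_eq_volume, hfr]
    _ ≤ μHE[d] (tangentProj M y '' (Metric.closedBall y ρ ∩ M)) := measure_mono himg
    _ ≤ μHE[d] (Metric.closedBall y ρ ∩ M) := by
        rw [Measure.euclideanHausdorffMeasure_def, Measure.euclideanHausdorffMeasure_def,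
          Measure.smul_apply, Measure.smul_apply]
        refine smul_le_smul_of_nonneg_left ?_ zero_le
        have := hproj.hausdorffMeasure_image_le (d := d) (by positivity)
          (Metric.closedBall y ρ ∩ M)
        simpa using this

variable {D d α β : ℕ} {μ : Measure (Amb D)} {Clog τ LM : ℝ} {M : Set (Amb D)} {p : Amb D → ℝ}

lemma IsAdmissible.ae_norm_le (h : IsAdmissible d α β μ Clog M τ LM p) :
    ∀ᵐ y ∂μ, y ∈ M ∧ ‖y‖ ≤ 1 := by
  have h1 : ∀ᵐ y ∂μ, y ∈ M := by
    rw [h.density.density]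
    exact (withDensity_absolutelyContinuous _ _).ae_le
      (ae_restrict_mem h.manifold.compact.measurableSet)
  filter_upwards [h1] with y hy
  refine ⟨hy, ?_⟩
  rw [← dist_zero_right]
  exact (Metric.dist_le_diam_of_mem h.manifold.compact.isBounded hy h.zero_mem).trans h.diam_le

lemma IsAdmissible.le_measureReal_closedBall [IsProbabilityMeasure μ]
    (h : IsAdmissible d α β μ Clog M τ LM p)
    {y : Amb D} (hy : y ∈ M) {ρ : ℝ} (hρ : 0 < ρ) (hρ1 : ρ ≤ 1) :
    Real.exp (-(4 * Clog ^ 2 + d * Real.log ρ⁻¹)) ≤ μ.real (Metric.closedBall y ρ) := by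
  have hlc := h.log_complexity
  have hd3 := h.manifold.three_le
  have hd3' : (3 : ℝ) ≤ d := by exact_mod_cast hd3
  have hC := max_lt_iff.1 hlc.gt_max
  have hmin := le_min_iff.1 hlc.le_min
  have hLM := h.manifold.const_pos
  -- Small enough for both `R ≤ τ / 8` and `LM * R ≤ ρ`, since `e^{-Clog}` is below `τ` and `1 /
  -- LM`.
  set R := ρ * Real.exp (-Clog) / 8 with hRdef
  have hR0 : 0 < R := by positivity
  have hRτ : R ≤ τ / 8 := by
    have : ρ * Real.exp (-Clog) ≤ 1 * τ := mul_le_mul hρ1 hmin.1 (Real.exp_pos _).le zero_le_one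
    rw [hRdef]; linarith
  have hRρ : LM * R ≤ ρ := by
    have h1 : LM * Real.exp (-Clog) ≤ 1 := by
      calc _ ≤ LM * LM⁻¹ := by gcongr; exact hmin.2
        _ = 1 := mul_inv_cancel₀ hLM.ne'
    have : LM * R = (LM * Real.exp (-Clog)) * (ρ / 8) := by rw [hRdef]; ring
    rw [this]
    nlinarith
  have hH := h.manifold.le_hausdorffMeasure_closedBall (by linarith [h.smoothness]) hy hR0.le hRτ hRρ
  have hμ : ENNReal.ofReal (Real.exp (-Clog)) * μHE[d] (Metric.closedBall y ρ ∩ M) ≤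
      μ (Metric.closedBall y ρ) := by
    rw [h.density.density, withDensity_apply _ measurableSet_closedBall,
      Measure.restrict_restrict measurableSet_closedBall]
    calc _ = ∫⁻ _ in Metric.closedBall y ρ ∩ M, ENNReal.ofReal (Real.exp (-Clog)) ∂μHE[d] := by
          rw [setLIntegral_const]
      _ ≤ _ := setLIntegral_mono' (measurableSet_closedBall.inter
          h.manifold.compact.measurableSet) fun z hz =>
            ENNReal.ofReal_le_ofReal (hlc.density_gt z hz.2).le
  have hμ2 : ENNReal.ofReal (Real.exp (-Clog) * (R / d) ^ d) ≤ μ (Metric.closedBall y ρ) := by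
    rw [ENNReal.ofReal_mul (Real.exp_pos _).le]
    exact le_trans (by gcongr) hμ
  have hμ3 : Real.exp (-Clog) * (R / d) ^ d ≤ μ.real (Metric.closedBall y ρ) :=
    (ENNReal.ofReal_le_iff_le_toReal (measure_ne_top _ _)).1 hμ2
  refine le_trans ?_ hμ3
  have e : Real.exp (-Clog) * (R / d) ^ d = Real.exp (-Clog + d * Real.log (R / d)) := by
    rw [Real.exp_add, mul_comm (d : ℝ), Real.exp_mul, Real.exp_log (by positivity),
      Real.rpow_natCast]
  rw [e]
  refine Real.exp_le_exp.2 ?_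
  have hlog : Real.log (R / d) = Real.log ρ - Clog - Real.log 8 - Real.log d := by
    rw [hRdef, Real.log_div (by positivity) (by positivity),
      Real.log_div (by positivity) (by positivity), Real.log_mul hρ.ne' (Real.exp_pos _).ne',
      Real.log_exp]
    ring
  have h8 : Real.log 8 ≤ Clog := by
    have : Real.log 8 = 3 * Real.log 2 := by
      rw [← Real.log_rpow (by norm_num)]; norm_num
    linarith [Real.log_two_lt_d9, hC.2]
  have hld : Real.log d ≤ Clog := (Real.log_le_self (by positivity)).trans hC.1.le
  rw [hlog, Real.log_inv]
  -- The exponent loses `Clog + d (Clog + log 8 + log d)`, which is at most `4 Clog²` because `log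
  -- 8`, `log d` and `d` are at most `Clog` and `Clog ≥ 1`.
  nlinarith [mul_nonneg (by positivity : (0 : ℝ) ≤ d) (sub_nonneg.2 h8),
    mul_nonneg (by positivity : (0 : ℝ) ≤ d) (sub_nonneg.2 hld),
    mul_nonneg (by linarith : (0 : ℝ) ≤ Clog) (sub_nonneg.2 hC.1.le)]

end SmallBalls

/-! ### Deterministic summation along the time grid. -/

section GridSums

lemma sum_sub_div_eq (v ρ : ℕ → ℝ) (n : ℕ) :
    ∑ k ∈ Finset.range n, (v k - v (k + 1)) / ρ k =
      v 0 / ρ 0 - v n / ρ n + ∑ k ∈ Finset.range n, v (k + 1) * ((ρ (k + 1))⁻¹ - (ρ k)⁻¹) := by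
  induction n with
  | zero => simp
  | succ n ih => rw [Finset.sum_range_succ, Finset.sum_range_succ, ih]; ring

lemma sum_succ_sub_le_sq (L n : ℕ) :
    ∑ k ∈ Finset.range n, (k + 1 - L) ≤ (n - L) ^ 2 := by
  induction n with
  | zero => simp
  | succ n ih =>
    rw [Finset.sum_range_succ]
    rcases le_or_gt (n + 1) L with h | h
    · have h1 : n + 1 - L = 0 := by omega
      have h2 : n - L = 0 := by omega
      rw [h1]
      rw [h2] at ih
      simpa using ih
    · obtain ⟨m, rfl⟩ : ∃ m, n = L + m := ⟨n - L, by omega⟩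
      have h1 : L + m + 1 - L = m + 1 := by omega
      have h2 : L + m - L = m := by omega
      rw [h1]
      rw [h2] at ih
      nlinarith

/-- Along a `κ`-decreasing grid the remaining times decrease at most geometrically. -/
lemma log_inv_le_of_grid {κ : ℝ} {K L : ℕ} {r : ℕ → ℝ} (hκ0 : 0 < κ) (hκ : κ < 1 / 4)
    (hr0 : 1 ≤ r 0) (hstep : ∀ k < K, r k - r (k + 1) ≤ κ * min 1 (r k))
    (hL1 : ∀ k < L, 1 ≤ r k)
    {j : ℕ} (hjK : j ≤ K) (hj : L ≤ j) :
    Real.log (r j)⁻¹ ≤ 2 * κ * ((j - L : ℕ) + 1) := by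
  have hgeo : ∀ i k, k + i ≤ K → (1 - κ) ^ i * r k ≤ r (k + i) := by
    intro i k
    induction i with
    | zero => simp
    | succ i ih =>
      intro hi
      have h1 := ih (by omega)
      have h2 := hstep (k + i) (by omega)
      have h3 : min 1 (r (k + i)) ≤ r (k + i) := min_le_right _ _
      have h4 : κ * min 1 (r (k + i)) ≤ κ * r (k + i) := by gcongr
      rw [pow_succ, ← add_assoc]
      nlinarith
  have h1κ : 0 < 1 - κ := by linarith
  -- Geometric decay is started at `L - 1`, the last index known to have `r ≥ 1`; hence the extra
  -- factor. For `L = 0` it starts at `r 0 ≥ 1`.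
  have key : (1 - κ) ^ (j - L + 1) ≤ r j := by
    rcases Nat.eq_zero_or_pos L with h0 | h0
    · have h := hgeo j 0 (by omega)
      rw [zero_add] at h
      subst h0
      have h2 : (1 - κ) ^ (j - 0 + 1) ≤ (1 - κ) ^ j :=
        pow_le_pow_of_le_one h1κ.le (by linarith) (by omega)
      have h3 : (1 - κ) ^ j ≤ (1 - κ) ^ j * r 0 := le_mul_of_one_le_right (by positivity) hr0
      linarith
    · have h := hgeo (j - L + 1) (L - 1) (by omega)
      have e : L - 1 + (j - L + 1) = j := by omega
      rw [e] at h
      exact (le_mul_of_one_le_right (by positivity) (hL1 (L - 1) (by omega))).trans h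
  have h2 : Real.log ((1 - κ) ^ (j - L + 1)) ≤ Real.log (r j) :=
    Real.log_le_log (by positivity) key
  rw [Real.log_pow] at h2
  have h3 : -(2 * κ) ≤ Real.log (1 - κ) := by
    have h4 := Real.one_sub_inv_le_log_of_pos h1κ
    have h5 : -(2 * κ) ≤ 1 - (1 - κ)⁻¹ := by
      rw [inv_eq_one_div, sub_eq_add_neg, ← neg_div, ← sub_nonneg]
      have : 1 + -1 / (1 - κ) - -(2 * κ) = κ * (1 - 2 * κ) / (1 - κ) := by field_simp; ring
      rw [this]
      refine div_nonneg (mul_nonneg hκ0.le (by linarith)) h1κ.le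
    linarith
  rw [Real.log_inv]
  push_cast at h2
  have h6 : (0 : ℝ) ≤ (j - L : ℕ) + 1 := by positivity
  nlinarith

/-- Here `V` is any bounded, nonnegative, monotone function that is Lipschitz away from zero and
nearly linear at zero. Bounding each increment of `V` near zero separately would lose its
telescoping, so the sum is treated by parts. -/
lemma sum_grid_le {V : ℝ → ℝ} {κ Clog : ℝ} {d K L : ℕ} {r : ℕ → ℝ} (hκ0 : 0 < κ)
    (hκ : κ < 1 / 4) (hr0 : 1 ≤ r 0) (hpos : ∀ k ≤ K, 0 < r k) (hlt : ∀ k < K, r (k + 1) ≤ r k)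
    (hstep : ∀ k < K, r k - r (k + 1) ≤ κ * min 1 (r k)) (hLK : L ≤ K) (hL1 : ∀ k < L, 1 ≤ r k)
    (hV0 : ∀ s, 0 ≤ V s) (hV4 : ∀ s, V s ≤ 4)
    (hmono : ∀ s t, 0 < s → s ≤ t → V s ≤ V t)
    (hLip : ∀ s t, 1 / 2 ≤ s → s ≤ t → V t - V s ≤ 32 * (t - s))
    (hsmall : ∀ s, 0 < s → s ≤ 1 → V s ≤ 864 * s * (Clog ^ 2 + d * Real.log s⁻¹))
    (hC : 4 < Clog) (hd : (d : ℝ) ≤ Clog) :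
    ∑ k ∈ Finset.range K, (r k - r (k + 1)) / min 1 (r k) ^ 2 * (V (r k) - V (r (k + 1))) ≤
      4000 * (K * κ ^ 2 * Clog ^ 3 + d ^ 3 * κ ^ 5 * ((K : ℝ) - L) ^ 4) := by
  have hρ : ∀ k ≤ K, 0 < min 1 (r k) := fun k hk => lt_min one_pos (hpos k hk)
  have hm0 : (0 : ℝ) ≤ (K : ℝ) - L := by
    rw [sub_nonneg]; exact_mod_cast hLK
  have hCsq : 1 ≤ Clog ^ 2 := by nlinarith
  have hCcub : Clog ^ 2 ≤ Clog ^ 3 := by nlinarith [sq_nonneg Clog]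
  have hdec : ∀ k < K, 0 ≤ V (r k) - V (r (k + 1)) := fun k hk =>
    sub_nonneg.2 (hmono _ _ (hpos _ (by omega)) (hlt k hk))
  -- If `K κ < 1/4`, all remaining times exceed `3/4`, and each term is `O(κ²)` by the Lipschitz
  -- bound.
  rcases lt_or_ge ((K : ℝ) * κ) (1 / 4) with hcase | hcase
  · have hlow : ∀ k ≤ K, 1 - k * κ ≤ r k := by
      intro k
      induction k with
      | zero => intro _; simpa using hr0
      | succ k ih =>
        intro hk
        have h1 := ih (by omega)
        have h2 := hstep k (by omega)
        have h3 : κ * min 1 (r k) ≤ κ := mul_le_of_le_one_right hκ0.le (min_le_left _ _)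
        push_cast
        linarith
    have hlow' : ∀ k ≤ K, 3 / 4 ≤ r k := by
      intro k hk
      have h1 := hlow k hk
      have h2 : (k : ℝ) * κ ≤ K * κ := by
        have : (k : ℝ) ≤ K := by exact_mod_cast hk
        gcongr
      linarith
    have hterm : ∀ k ∈ Finset.range K, (r k - r (k + 1)) / min 1 (r k) ^ 2 *
        (V (r k) - V (r (k + 1))) ≤ 64 * κ ^ 2 := by
      intro k hk
      have hk' := Finset.mem_range.1 hk
      have h1 := hlow' k hk'.le
      have h2 : 3 / 4 ≤ min 1 (r k) := le_min (by norm_num) h1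
      have h3 : r k - r (k + 1) ≤ κ := (hstep k hk').trans
        (mul_le_of_le_one_right hκ0.le (min_le_left _ _))
      have h4 := hLip (r (k + 1)) (r k) (by linarith [hlow' (k + 1) (by omega)]) (hlt k hk')
      have h5 : (r k - r (k + 1)) / min 1 (r k) ^ 2 ≤ 2 * κ := by
        have h6 : (3 / 4 : ℝ) ^ 2 ≤ min 1 (r k) ^ 2 := pow_le_pow_left₀ (by norm_num) h2 2
        rw [div_le_iff₀ (by positivity)]
        nlinarith
      calc _ ≤ (2 * κ) * (32 * κ) := mul_le_mul h5 (by linarith) (hdec k hk') (by positivity)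
        _ = 64 * κ ^ 2 := by ring
    refine (Finset.sum_le_sum hterm).trans ?_
    rw [Finset.sum_const, Finset.card_range, nsmul_eq_mul]
    have h1 : 0 ≤ (d : ℝ) ^ 3 * κ ^ 5 * ((K : ℝ) - L) ^ 4 := by positivity
    have h2 : (K : ℝ) * κ ^ 2 * 1 ≤ K * κ ^ 2 * Clog ^ 3 := by
      gcongr; linarith
    nlinarith
  · have hfirst : ∀ k ∈ Finset.range K, (r k - r (k + 1)) / min 1 (r k) ^ 2 *
        (V (r k) - V (r (k + 1))) ≤ κ * ((V (r k) - V (r (k + 1))) / min 1 (r k)) := by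
      intro k hk
      have hk' := Finset.mem_range.1 hk
      have h0 := hρ k hk'.le
      have h1 : (r k - r (k + 1)) / min 1 (r k) ^ 2 ≤ κ / min 1 (r k) := by
        rw [div_le_div_iff₀ (by positivity) h0, sq, ← mul_assoc]
        exact mul_le_mul_of_nonneg_right (hstep k hk') h0.le
      calc _ ≤ κ / min 1 (r k) * (V (r k) - V (r (k + 1))) :=
            mul_le_mul_of_nonneg_right h1 (hdec k hk')
        _ = _ := by ring
    -- The reciprocal changes only once `r (k + 1) < 1`, by at most `κ / r (k + 1)`; the near-linear
    -- bound on `V` cancels this singularity. The truncated subtraction `k + 1 - L` vanishes before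
    -- the final phase.
    have hsecond : ∀ k ∈ Finset.range K, V (r (k + 1)) * ((min 1 (r (k + 1)))⁻¹ -
        (min 1 (r k))⁻¹) ≤ 1728 * κ * (Clog ^ 2 + d * κ * ((k + 1 - L : ℕ) : ℝ)) := by
      intro k hk
      have hk' := Finset.mem_range.1 hk
      have hp := hpos (k + 1) (by omega)
      have hrhs : 0 ≤ 1728 * κ * (Clog ^ 2 + d * κ * ((k + 1 - L : ℕ) : ℝ)) := by positivity
      rcases le_or_gt 1 (r (k + 1)) with h1 | h1
      · rw [min_eq_left h1, min_eq_left (h1.trans (hlt k hk')), sub_self, mul_zero]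
        exact hrhs
      have hLk : L ≤ k + 1 := by
        by_contra hcon
        exact absurd (hL1 (k + 1) (by omega)) (not_le.2 h1)
      have hlog := log_inv_le_of_grid hκ0 hκ hr0 hstep hL1 (j := k + 1) (by omega) hLk
      have hdiff : (min 1 (r (k + 1)))⁻¹ - (min 1 (r k))⁻¹ ≤ κ / r (k + 1) := by
        have h0 := hρ k hk'.le
        rw [min_eq_right h1.le, ← sub_nonneg]
        have e : κ / r (k + 1) - ((r (k + 1))⁻¹ - (min 1 (r k))⁻¹) =
            (κ * min 1 (r k) - (min 1 (r k) - r (k + 1))) / (r (k + 1) * min 1 (r k)) := by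
          field_simp
        rw [e]
        refine div_nonneg ?_ (by positivity)
        have h2 := hstep k hk'
        have h3 : min 1 (r k) ≤ r k := min_le_right _ _
        linarith
      have hVs := hsmall _ hp h1.le
      have hdlog : d * Real.log (r (k + 1))⁻¹ ≤
          Clog ^ 2 + 2 * (d * κ * ((k + 1 - L : ℕ) : ℝ)) := by
        have h2 : d * Real.log (r (k + 1))⁻¹ ≤ d * (2 * κ * ((k + 1 - L : ℕ) + 1)) := by gcongr
        have h3 : (d : ℝ) * (2 * κ) ≤ Clog ^ 2 := by
          have : (d : ℝ) * (2 * κ) ≤ Clog * 1 := by gcongr; linarith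
          nlinarith
        nlinarith
      calc V (r (k + 1)) * ((min 1 (r (k + 1)))⁻¹ - (min 1 (r k))⁻¹)
          ≤ V (r (k + 1)) * (κ / r (k + 1)) := by gcongr; exact hV0 _
        _ ≤ (864 * r (k + 1) * (Clog ^ 2 + d * Real.log (r (k + 1))⁻¹)) * (κ / r (k + 1)) := by
            gcongr
        _ = 864 * κ * (Clog ^ 2 + d * Real.log (r (k + 1))⁻¹) := by field_simp
        _ ≤ 864 * κ * (2 * (Clog ^ 2 + d * κ * ((k + 1 - L : ℕ) : ℝ))) := by
            gcongr; linarith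
        _ = _ := by ring
    have hsum := sum_sub_div_eq (fun k => V (r k)) (fun k => min 1 (r k)) K
    have hb0 : V (r 0) / min 1 (r 0) ≤ 4 := by
      rw [min_eq_left hr0, div_one]; exact hV4 _
    have hbK : 0 ≤ V (r K) / min 1 (r K) := div_nonneg (hV0 _) (hρ K le_rfl).le
    have hcount : ((∑ k ∈ Finset.range K, (k + 1 - L) : ℕ) : ℝ) ≤ ((K : ℝ) - L) ^ 2 := by
      have h1 := sum_succ_sub_le_sq L K
      have h2 : ((K - L : ℕ) : ℝ) = (K : ℝ) - L := Nat.cast_sub hLK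
      rw [← h2]
      exact_mod_cast h1
    have htot : ∑ k ∈ Finset.range K, V (r (k + 1)) * ((min 1 (r (k + 1)))⁻¹ -
        (min 1 (r k))⁻¹) ≤ 1728 * κ * (K * Clog ^ 2 + d * κ * ((K : ℝ) - L) ^ 2) := by
      refine (Finset.sum_le_sum hsecond).trans ?_
      rw [← Finset.mul_sum, Finset.sum_add_distrib, Finset.sum_const, Finset.card_range,
        nsmul_eq_mul, ← Finset.mul_sum, ← Nat.cast_sum]
      gcongr
    -- Using `x ≤ 1 + x³` splits `κ² (K - L) x` into a part below `K κ²` and exactly the term `d³ κ⁵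
    -- (K - L)^4`.
    have hx : d * κ * ((K : ℝ) - L) ≤ 1 + (d * κ * ((K : ℝ) - L)) ^ 3 := by
      have h0 : 0 ≤ d * κ * ((K : ℝ) - L) := by positivity
      generalize d * κ * ((K : ℝ) - L) = x at h0
      nlinarith [sq_nonneg (x - 1), mul_nonneg h0 (sq_nonneg (x - 1))]
    have hquad : κ ^ 2 * (d * κ * ((K : ℝ) - L) ^ 2) ≤
        K * κ ^ 2 + d ^ 3 * κ ^ 5 * ((K : ℝ) - L) ^ 4 := by
      have hKL : (K : ℝ) - L ≤ K := by
        have : (0 : ℝ) ≤ L := by positivity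
        linarith
      calc κ ^ 2 * (d * κ * ((K : ℝ) - L) ^ 2)
          = κ ^ 2 * ((K : ℝ) - L) * (d * κ * ((K : ℝ) - L)) := by ring
        _ ≤ κ ^ 2 * ((K : ℝ) - L) * (1 + (d * κ * ((K : ℝ) - L)) ^ 3) := by gcongr
        _ = κ ^ 2 * ((K : ℝ) - L) + d ^ 3 * κ ^ 5 * ((K : ℝ) - L) ^ 4 := by ring
        _ ≤ κ ^ 2 * K + d ^ 3 * κ ^ 5 * ((K : ℝ) - L) ^ 4 := by gcongr
        _ = _ := by ring
    refine (Finset.sum_le_sum hfirst).trans ?_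
    rw [← Finset.mul_sum, hsum]
    calc κ * (V (r 0) / min 1 (r 0) - V (r K) / min 1 (r K) +
          ∑ k ∈ Finset.range K, V (r (k + 1)) * ((min 1 (r (k + 1)))⁻¹ - (min 1 (r k))⁻¹))
        ≤ κ * (4 + 1728 * κ * (K * Clog ^ 2 + d * κ * ((K : ℝ) - L) ^ 2)) := by
          refine mul_le_mul_of_nonneg_left ?_ hκ0.le
          linarith
      _ = 4 * κ + 1728 * (K * κ ^ 2 * Clog ^ 2) +
          1728 * (κ ^ 2 * (d * κ * ((K : ℝ) - L) ^ 2)) := by ring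
      _ ≤ 16 * (K * κ ^ 2 * Clog ^ 3) + 1728 * (K * κ ^ 2 * Clog ^ 3) +
          1728 * (K * κ ^ 2 * Clog ^ 3 + d ^ 3 * κ ^ 5 * ((K : ℝ) - L) ^ 4) := by
          -- The only place where `K κ ≥ 1/4` is needed.
          have h1 : 4 * κ ≤ 16 * (K * κ ^ 2) := by nlinarith
          have h2 : (K : ℝ) * κ ^ 2 * 1 ≤ K * κ ^ 2 * Clog ^ 3 := by gcongr; linarith
          have h3 : (K : ℝ) * κ ^ 2 * Clog ^ 2 ≤ K * κ ^ 2 * Clog ^ 3 := by gcongr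
          linarith
      _ ≤ _ := by
          have h1 : 0 ≤ (d : ℝ) ^ 3 * κ ^ 5 * ((K : ℝ) - L) ^ 4 := by positivity
          have h2 : 0 ≤ (K : ℝ) * κ ^ 2 * Clog ^ 3 := by positivity
          linarith

end GridSums

/-! ### Noise levels and the mean squared error as a function of time. -/

section Rates

lemma ouC_mul_ouC (s t : ℝ) : ouC s * ouC t = ouC (s + t) := by
  rw [ouC, ouC, ouC, ← Real.exp_add]; congr 1; ring

/-- Rescaling from noise level `s` to the larger noise level `r`. -/
lemma scale_sq_add_sq {s r : ℝ} (hs : 0 < s) (hsr : s ≤ r) :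
    (ouC (r - s) * ouSigma s / ouSigma r) ^ 2 + (ouSigma (r - s) / ouSigma r) ^ 2 = 1 := by
  have hr : 0 < r := hs.trans_le hsr
  have h := ouSigma_pos hr
  rw [div_pow, div_pow, ← add_div, div_eq_one_iff_eq (by positivity), mul_pow, ouC_sq,
    ouSigma_sq hs.le, ouSigma_sq hr.le, ouSigma_sq (sub_nonneg.2 hsr), mul_sub, ← Real.exp_add]
  ring_nf

lemma scale_mul_ratio {s r : ℝ} (hs : 0 < s) (hsr : s ≤ r) :
    ouC (r - s) * ouSigma s / ouSigma r * (ouC s / ouSigma s) = ouC r / ouSigma r := by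
  have h1 := ouSigma_pos hs
  have h2 := ouSigma_pos (hs.trans_le hsr)
  have h3 : ouC (r - s) * ouC s = ouC r := by rw [ouC_mul_ouC]; ring_nf
  rw [← h3]
  field_simp

lemma mmse_ou_mono {D : ℕ} {μ : Measure (Amb D)} [IsProbabilityMeasure μ]
    (hμ : ∀ᵐ y ∂μ, ‖y‖ ≤ 1) {s r : ℝ} (hs : 0 < s) (hsr : s ≤ r) :
    mmse μ (ouC s / ouSigma s) ≤ mmse μ (ouC r / ouSigma r) := by
  rw [← scale_mul_ratio hs hsr]
  refine mmse_le_mmse_mul hμ _ ?_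
  nlinarith [scale_sq_add_sq hs hsr, sq_nonneg (ouSigma (r - s) / ouSigma r)]

lemma ratio_eq {s : ℝ} (hs : 0 < s) :
    ouC s / ouSigma s = (Real.sqrt (Real.exp (2 * s) - 1))⁻¹ := by
  have h1 := ouSigma_pos hs
  have h2 : 0 < Real.exp (2 * s) - 1 := by
    have := Real.add_one_le_exp (2 * s)
    linarith
  have h3 : ouSigma s = ouC s * Real.sqrt (Real.exp (2 * s) - 1) := by
    rw [← Real.sqrt_sq (ouC_pos s).le, ← Real.sqrt_mul (sq_nonneg _), ouSigma, ouC_sq]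
    congr 1
    rw [mul_sub, ← Real.exp_add]
    simp
  have h4 := Real.sqrt_pos.2 h2
  have h5 := ouC_pos s
  rw [h3]
  field_simp

lemma ratio_sub_le {s r : ℝ} (hs : 1 / 2 ≤ s) (hsr : s ≤ r) :
    |ouC r / ouSigma r - ouC s / ouSigma s| ≤ 4 * (r - s) := by
  rw [ratio_eq (by linarith), ratio_eq (by linarith)]
  have hx1 : 1 ≤ Real.exp (2 * s) - 1 := by
    have := Real.add_one_le_exp (2 * s)
    linarith
  have hE : Real.exp (2 * s) = Real.exp (2 * r) * Real.exp (-(2 * (r - s))) := by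
    rw [← Real.exp_add]; ring_nf
  have hlow := Real.one_sub_le_exp_neg (2 * (r - s))
  have hy : Real.exp (2 * s) ≤ Real.exp (2 * r) := Real.exp_le_exp.2 (by linarith)
  set x := Real.exp (2 * s) - 1 with hx
  set y := Real.exp (2 * r) - 1 with hyd
  have hxy : x ≤ y := by linarith
  -- From `1 - e^{-h} ≤ h` with `h = 2 (r - s)`, and `e^{2r} = y + 1 ≤ 2 y`; this is where `s ≥ 1/2`
  -- matters.
  have hyx : y - x ≤ 4 * (r - s) * y := by
    have h1 : Real.exp (2 * r) * (1 - 2 * (r - s)) ≤ Real.exp (2 * s) := by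
      rw [hE]; gcongr
    nlinarith
  have hu1 : 1 ≤ Real.sqrt x := Real.one_le_sqrt.2 hx1
  have huv : Real.sqrt x ≤ Real.sqrt y := Real.sqrt_le_sqrt hxy
  have hux : Real.sqrt x ^ 2 = x := Real.sq_sqrt (by linarith)
  have hvy : Real.sqrt y ^ 2 = y := Real.sq_sqrt (by linarith)
  rw [abs_sub_comm, abs_of_nonneg (sub_nonneg.2 (inv_anti₀ (by linarith) huv))]
  generalize Real.sqrt x = u at *
  generalize Real.sqrt y = v at *
  have e : u⁻¹ - v⁻¹ = (v - u) / (u * v) := by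
    have : u ≠ 0 := by linarith
    have : v ≠ 0 := by linarith
    field_simp
  rw [e, div_le_iff₀ (by nlinarith)]
  have hv : 0 < v := by linarith
  have h2 : (v - u) * v ≤ (4 * (r - s) * (u * v)) * v := by
    have h3 : (v - u) * v ≤ v ^ 2 - u ^ 2 := by nlinarith
    have h4 : 4 * (r - s) * v ^ 2 * 1 ≤ 4 * (r - s) * v ^ 2 * u := by
      have : 0 ≤ 4 * (r - s) * v ^ 2 := mul_nonneg (by linarith) (sq_nonneg v)
      gcongr
    rw [hux, hvy] at h3
    rw [hvy] at h4
    have h5 : (4 * (r - s) * (u * v)) * v = 4 * (r - s) * y * u := by rw [← hvy]; ring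
    linarith
  exact le_of_mul_le_mul_right h2 hv

lemma mmse_ou_lipschitz {D : ℕ} {μ : Measure (Amb D)} [IsProbabilityMeasure μ]
    (hμ : ∀ᵐ y ∂μ, ‖y‖ ≤ 1) {s r : ℝ} (hs : 1 / 2 ≤ s) (hsr : s ≤ r) :
    mmse μ (ouC r / ouSigma r) - mmse μ (ouC s / ouSigma s) ≤ 32 * (r - s) := by
  have h1 := mmse_le_mmse_add hμ (ouC s / ouSigma s) (ouC r / ouSigma r)
  have h2 := ratio_sub_le hs hsr
  linarith

lemma ouSigma_sq_le {s : ℝ} (hs : 0 ≤ s) : ouSigma s ^ 2 ≤ 2 * s := by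
  rw [ouSigma_sq hs]
  have := Real.add_one_le_exp (-2 * s)
  linarith

lemma le_ouSigma_sq {s : ℝ} (hs : 0 ≤ s) (hs1 : s ≤ 1) : 2 / 3 * s ≤ ouSigma s ^ 2 := by
  rw [ouSigma_sq hs]
  have h1 := Real.add_one_le_exp (2 * s)
  have h2 : Real.exp (-2 * s) * Real.exp (2 * s) = 1 := by
    rw [← Real.exp_add]; simp
  have h3 := Real.exp_pos (-2 * s)
  have h4 : Real.exp (-2 * s) * (1 + 2 * s) ≤ 1 := by nlinarith
  have h5 : 1 ≤ (1 - 2 / 3 * s) * (1 + 2 * s) := by nlinarith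
  nlinarith

lemma ouSigma_sq_le_one (s : ℝ) (hs : 0 ≤ s) : ouSigma s ^ 2 ≤ 1 := by
  rw [ouSigma_sq hs]
  linarith [Real.exp_pos (-2 * s)]

lemma ouC_le_one {s : ℝ} (hs : 0 ≤ s) : ouC s ≤ 1 := by
  rw [ouC, Real.exp_le_one_iff]; linarith

/-- The small-ball bound is used at radius `σ_s`, where the bias `a² ρ²` becomes `c_s² ≤ 1`. With
`σ_s² ≤ 2 s` and `c_s² ≥ 1/8` the constant is `8 * 8 * 2 * 5 = 640`, below the stated one. -/
lemma mmse_ou_le {D d α β : ℕ} {μ : Measure (Amb D)} [IsProbabilityMeasure μ] {Clog : ℝ}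
    {M : Set (Amb D)} {τ LM : ℝ} {p : Amb D → ℝ} (h : IsAdmissible d α β μ Clog M τ LM p)
    {s : ℝ} (hs : 0 < s) (hs1 : s ≤ 1) :
    mmse μ (ouC s / ouSigma s) ≤ 864 * s * (Clog ^ 2 + d * Real.log s⁻¹) := by
  have hμ : ∀ᵐ y ∂μ, ‖y‖ ≤ 1 := h.ae_norm_le.mono fun y hy => hy.2
  have hσ := ouSigma_pos hs
  have hσ1 : ouSigma s ≤ 1 := by
    have := ouSigma_sq_le_one s hs.le
    nlinarith
  have hB : ∀ᵐ y ∂μ, Real.exp (-(4 * Clog ^ 2 + d * Real.log (ouSigma s)⁻¹)) ≤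
      μ.real (Metric.closedBall y (ouSigma s)) :=
    h.ae_norm_le.mono fun y hy => h.le_measureReal_closedBall hy.1 hσ hσ1
  have hmain := mmse_le_of_measure_closedBall hμ (ouC s / ouSigma s) hB
  have hσs := le_ouSigma_sq hs.le hs1
  have hσ2 := ouSigma_sq_le hs.le
  have hV := mmse_nonneg (μ := μ) (ouC s / ouSigma s)
  have hC := h.log_complexity.gt_max
  have hC4 : 4 < Clog := (le_max_right _ _).trans_lt hC
  have hCd : (d : ℝ) < Clog := (le_max_left _ _).trans_lt hC
  have hls : 0 ≤ Real.log s⁻¹ := Real.log_nonneg ((one_le_inv₀ hs).2 hs1)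
  have hlog : Real.log (ouSigma s)⁻¹ ≤ 1 + Real.log s⁻¹ := by
    have h1 : Real.log (s / 2) ≤ Real.log (ouSigma s ^ 2) :=
      Real.log_le_log (by positivity) (by linarith)
    rw [Real.log_pow, Real.log_div hs.ne' two_ne_zero] at h1
    have h2 := Real.log_two_lt_d9
    rw [Real.log_inv] at hls ⊢
    rw [Real.log_inv]
    push_cast at h1
    linarith
  have hdlog : d * Real.log (ouSigma s)⁻¹ ≤ d + d * Real.log s⁻¹ := by
    have : d * Real.log (ouSigma s)⁻¹ ≤ d * (1 + Real.log s⁻¹) := by gcongr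
    linarith
  have hc9 : 1 / 8 ≤ ouC s ^ 2 := by
    rw [ouC_sq]
    have h1 : Real.exp (-2) ≤ Real.exp (-2 * s) := Real.exp_le_exp.2 (by linarith)
    have h2 : Real.exp 2 ≤ 8 := by
      have h3 := Real.exp_one_lt_d9
      have h4 : Real.exp 2 = Real.exp 1 * Real.exp 1 := by rw [← Real.exp_add]; norm_num
      rw [h4]
      nlinarith [Real.exp_pos 1]
    have h5 : Real.exp (-2) * Real.exp 2 = 1 := by rw [← Real.exp_add]; simp
    nlinarith [Real.exp_pos (-2)]
  have hc1 : ouC s ^ 2 ≤ 1 := by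
    rw [ouC_sq, Real.exp_le_one_iff]; linarith
  have e1 : (ouC s / ouSigma s) ^ 2 * ouSigma s ^ 2 = ouC s ^ 2 := by
    field_simp
  rw [e1] at hmain
  have hmain2 : ouC s ^ 2 * mmse μ (ouC s / ouSigma s) ≤
      8 * ouSigma s ^ 2 * (4 * Clog ^ 2 + d * Real.log (ouSigma s)⁻¹ + ouC s ^ 2 / 4) := by
    calc _ = 8 * ouSigma s ^ 2 * ((ouC s / ouSigma s) ^ 2 / 8 * mmse μ (ouC s / ouSigma s)) := by
          field_simp
      _ ≤ _ := by gcongr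
  have hdl : 0 ≤ d * Real.log s⁻¹ := by positivity
  have hsum : 4 * Clog ^ 2 + d * Real.log (ouSigma s)⁻¹ + ouC s ^ 2 / 4 ≤
      5 * (Clog ^ 2 + d * Real.log s⁻¹) := by nlinarith
  have hfin : ouC s ^ 2 * mmse μ (ouC s / ouSigma s) ≤
      8 * (2 * s) * (5 * (Clog ^ 2 + d * Real.log s⁻¹)) := by
    refine hmain2.trans ((mul_le_mul_of_nonneg_left hsum (by positivity)).trans ?_)
    gcongr
  have h8 : 1 / 8 * mmse μ (ouC s / ouSigma s) ≤ ouC s ^ 2 * mmse μ (ouC s / ouSigma s) := by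
    gcongr
  have hpos : 0 ≤ s * (Clog ^ 2 + d * Real.log s⁻¹) := by positivity
  nlinarith

/-- Meant for `ρ = min 1 r`: a step of length at most `ρ / 4` back from `r` stays above `3 ρ / 4`.
-/
lemma half_le_ouSigma_sq {s ρ : ℝ} (hρ : 0 < ρ) (hρ1 : ρ ≤ 1) (hs : 3 / 4 * ρ ≤ s) :
    ρ / 2 ≤ ouSigma s ^ 2 := by
  have h1 := le_ouSigma_sq (s := 3 / 4 * ρ) (by positivity) (by linarith)
  have h2 : ouSigma (3 / 4 * ρ) ^ 2 ≤ ouSigma s ^ 2 := by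
    rw [ouSigma_sq (by positivity), ouSigma_sq (le_trans (by positivity) hs)]
    have : Real.exp (-2 * s) ≤ Real.exp (-2 * (3 / 4 * ρ)) := Real.exp_le_exp.2 (by linarith)
    linarith
  linarith

lemma ouC_div_sq_le {s ρ : ℝ} (hρ : 0 < ρ) (hρ1 : ρ ≤ 1) (hs : 3 / 4 * ρ ≤ s) :
    (ouC s / ouSigma s ^ 2) ^ 2 ≤ 4 / ρ ^ 2 := by
  have h1 := half_le_ouSigma_sq hρ hρ1 hs
  have h2 := ouC_le_one (s := s) (le_trans (by positivity) hs)
  have h3 := ouC_pos s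
  have h4 : ouC s / ouSigma s ^ 2 ≤ 1 / (ρ / 2) := by gcongr
  calc _ ≤ (1 / (ρ / 2)) ^ 2 := by gcongr
    _ = 4 / ρ ^ 2 := by field_simp; norm_num

lemma modified_weight_sq_le {s r : ℝ} (hr : 0 < r) (hs : r - s ≤ 1 / 4 * min 1 r) :
    ((ouC (r - s))⁻¹ * (ouSigma r ^ 2 / ouSigma s ^ 2)) ^ 2 ≤ 36 := by
  have hρ : 0 < min 1 r := lt_min one_pos hr
  have hρ1 : min 1 r ≤ 1 := min_le_left _ _
  have hρr : min 1 r ≤ r := min_le_right _ _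
  have h1 := half_le_ouSigma_sq hρ hρ1 (s := s) (by linarith)
  have h2 : ouSigma r ^ 2 ≤ 2 * min 1 r := by
    rcases le_total 1 r with h | h
    · rw [min_eq_left h]
      linarith [ouSigma_sq_le_one r hr.le]
    · rw [min_eq_right h]
      exact ouSigma_sq_le hr.le
  have h3 : 3 / 4 ≤ ouC (r - s) := by
    have := Real.add_one_le_exp (-(r - s))
    rw [ouC]
    linarith
  have h4 : ouSigma r ^ 2 / ouSigma s ^ 2 ≤ 4 := by
    rw [div_le_iff₀ (by linarith)]
    linarith
  have h5 : (ouC (r - s))⁻¹ ≤ 4 / 3 := by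
    rw [inv_le_comm₀ (by linarith) (by norm_num)]
    linarith
  have h6 : (ouC (r - s))⁻¹ * (ouSigma r ^ 2 / ouSigma s ^ 2) ≤ 4 / 3 * 4 := by gcongr
  have h7 : 0 ≤ (ouC (r - s))⁻¹ * (ouSigma r ^ 2 / ouSigma s ^ 2) := by
    have := ouC_pos (r - s)
    positivity
  nlinarith

end Rates

/-! ### Expected error at a fixed time within a step. -/

section Loss

/-- After division by `σ_s` and `σ_r` the pair `(X(s), X(r))` becomes the degraded channel with `b =
c_{r-s} σ_s / σ_r` and `e = σ_{r-s} / σ_r`, so the Pythagorean identity applies. -/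
lemma lintegral_postMean_sub_sq {D : ℕ} {Ω : Type*} [MeasurableSpace Ω] {P : Measure Ω}
    [IsProbabilityMeasure P] {μ : Measure (Amb D)} [IsProbabilityMeasure μ]
    (hμ : ∀ᵐ y ∂μ, ‖y‖ ≤ 1) {X : ℝ≥0 → Ω → Amb D} (hX : IsForwardProcess μ X P) {s r : ℝ}
    (hs : 0 < s) (hsr : s ≤ r) :
    ∫⁻ ω, ‖postMean μ (ouC r / ouSigma r) ((ouSigma r)⁻¹ • X r.toNNReal ω) -
      postMean μ (ouC s / ouSigma s) ((ouSigma s)⁻¹ • X s.toNNReal ω)‖ₑ ^ 2 ∂P =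
      ENNReal.ofReal (mmse μ (ouC r / ouSigma r) - mmse μ (ouC s / ouSigma s)) := by
  have hσs := ouSigma_pos hs
  have hσr := ouSigma_pos (hs.trans_le hsr)
  have hm1 := measurable_postMean (μ := μ) (ouC r / ouSigma r)
  have hm2 := measurable_postMean (μ := μ) (ouC s / ouSigma s)
  let g : Amb D × Amb D → Amb D := fun x => postMean μ (ouC r / ouSigma r) ((ouSigma r)⁻¹ • x.2) -
    postMean μ (ouC s / ouSigma s) ((ouSigma s)⁻¹ • x.1)
  have hg : Measurable g := by fun_prop
  have hpair : Measurable fun ω => (X s.toNNReal ω, X r.toNNReal ω) :=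
    (hX.measurable _).prodMk (hX.measurable _)
  have e1 : ∫⁻ ω, ‖g (X s.toNNReal ω, X r.toNNReal ω)‖ₑ ^ 2 ∂P =
      ∫⁻ x, ‖g x‖ₑ ^ 2 ∂(P.map fun ω => (X s.toNNReal ω, X r.toNNReal ω)) :=
    (lintegral_map (f := fun x => ‖g x‖ₑ ^ 2) (by fun_prop) hpair).symm
  refine e1.trans ?_
  rw [hX.map_pair hs.le hsr, lintegral_map (by fun_prop) (by fun_prop)]
  have ha : ∀ y z : Amb D, (ouSigma s)⁻¹ • (ouC s • y + ouSigma s • z) =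
      (ouC s / ouSigma s) • y + z := by
    intro y z
    rw [smul_add, smul_smul, smul_smul, inv_mul_cancel₀ hσs.ne', one_smul, div_eq_inv_mul]
  have hb : ∀ y z z' : Amb D, (ouSigma r)⁻¹ • (ouC (r - s) • (ouC s • y + ouSigma s • z) +
      ouSigma (r - s) • z') = (ouC (r - s) * ouSigma s / ouSigma r) •
        ((ouC s / ouSigma s) • y + z) + (ouSigma (r - s) / ouSigma r) • z' := by
    intro y z z'
    rw [← ha, smul_add, smul_smul, smul_smul, smul_smul]
    congr 2 <;> field_simp
  have e2 := integral_norm_postMean_sub_sq hμ (ouC s / ouSigma s) (scale_sq_add_sq hs hsr)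
  rw [scale_mul_ratio hs hsr] at e2
  rw [← e2, ofReal_integral_eq_lintegral_ofReal]
  · refine lintegral_congr fun q => ?_
    rw [ENNReal.ofReal_pow (norm_nonneg _), ofReal_norm]
    simp only [g, ha, hb]
  · refine integrable_prod_of_bound hμ (by fun_prop) (C := 2 ^ 2) fun q _ => ?_
    rw [Real.norm_of_nonneg (by positivity)]
    refine pow_le_pow_left₀ (norm_nonneg _) ((norm_sub_le _ _).trans ?_) 2
    exact (add_le_add (norm_postMean_le hμ _ _) (norm_postMean_le hμ _ _)).trans (by norm_num)
  · exact Filter.Eventually.of_forall fun q => by positivity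

/-- From `‖u + v‖² ≤ 2 ‖u‖² + 2 ‖v‖²` in the error decomposition: `72 = 2 * 36` and `8 = 2 * 4` come
from the bounds on the squared weights. -/
lemma lintegral_modifiedScore_sub_score_le {D : ℕ} {Ω : Type*} [MeasurableSpace Ω]
    {P : Measure Ω} [IsProbabilityMeasure P] {μ : Measure (Amb D)} [IsProbabilityMeasure μ]
    (hμ : ∀ᵐ y ∂μ, ‖y‖ ≤ 1) {X : ℝ≥0 → Ω → Amb D} (hX : IsForwardProcess μ X P)
    (shat : ℝ → Amb D → Amb D) {s r : ℝ} (hr : 0 < r) (hsr : s ≤ r)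
    (hs : r - s ≤ 1 / 4 * min 1 r) :
    ∫⁻ ω, ‖modifiedScore shat r s (X s.toNNReal ω) (X r.toNNReal ω) -
      score μ s (X s.toNNReal ω)‖ₑ ^ 2 ∂P ≤
    72 * ∫⁻ ω, ‖shat r (X r.toNNReal ω) - score μ r (X r.toNNReal ω)‖ₑ ^ 2 ∂P +
      ENNReal.ofReal (8 / min 1 r ^ 2 *
        (mmse μ (ouC r / ouSigma r) - mmse μ (ouC s / ouSigma s))) := by
  have hρ : 0 < min 1 r := lt_min one_pos hr
  have hs0 : 0 < s := by linarith [min_le_right 1 r]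
  have hA := modified_weight_sq_le hr hs
  have hB := ouC_div_sq_le hρ (min_le_left _ _) (s := s) (by linarith [min_le_right 1 r])
  have hpt : ∀ ω, ‖modifiedScore shat r s (X s.toNNReal ω) (X r.toNNReal ω) -
      score μ s (X s.toNNReal ω)‖ₑ ^ 2 ≤
      72 * ‖shat r (X r.toNNReal ω) - score μ r (X r.toNNReal ω)‖ₑ ^ 2 +
      ENNReal.ofReal (8 / min 1 r ^ 2) *
        ‖postMean μ (ouC r / ouSigma r) ((ouSigma r)⁻¹ • X r.toNNReal ω) -
          postMean μ (ouC s / ouSigma s) ((ouSigma s)⁻¹ • X s.toNNReal ω)‖ₑ ^ 2 := by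
    intro ω
    rw [modifiedScore_sub_score hμ shat hs0 hr]
    generalize shat r (X r.toNNReal ω) - score μ r (X r.toNNReal ω) = u
    generalize postMean μ (ouC r / ouSigma r) ((ouSigma r)⁻¹ • X r.toNNReal ω) -
          postMean μ (ouC s / ouSigma s) ((ouSigma s)⁻¹ • X s.toNNReal ω) = v
    generalize (ouC (r - s))⁻¹ * (ouSigma r ^ 2 / ouSigma s ^ 2) = a at hA
    generalize ouC s / ouSigma s ^ 2 = b at hB
    have e : (72 : ℝ≥0∞) = ENNReal.ofReal 72 := by simp
    rw [e, ← ofReal_norm, ← ofReal_norm, ← ofReal_norm,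
      ← ENNReal.ofReal_pow (norm_nonneg _), ← ENNReal.ofReal_pow (norm_nonneg _),
      ← ENNReal.ofReal_pow (norm_nonneg _), ← ENNReal.ofReal_mul (by norm_num),
      ← ENNReal.ofReal_mul (by positivity), ← ENNReal.ofReal_add (by positivity) (by positivity)]
    refine ENNReal.ofReal_le_ofReal ?_
    have h1 : ‖a • u + b • v‖ ^ 2 ≤ (‖a • u‖ + ‖b • v‖) ^ 2 := by
      gcongr
      exact norm_add_le _ _
    have h2 : ‖a • u‖ ^ 2 ≤ 36 * ‖u‖ ^ 2 := by
      rw [norm_smul, mul_pow, Real.norm_eq_abs, sq_abs]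
      gcongr
    have h3 : ‖b • v‖ ^ 2 ≤ 4 / min 1 r ^ 2 * ‖v‖ ^ 2 := by
      rw [norm_smul, mul_pow, Real.norm_eq_abs, sq_abs]
      gcongr
    have h4 : 8 / min 1 r ^ 2 * ‖v‖ ^ 2 = 2 * (4 / min 1 r ^ 2 * ‖v‖ ^ 2) := by ring
    nlinarith [sq_nonneg (‖a • u‖ - ‖b • v‖)]
  have hm1 := measurable_postMean (μ := μ) (ouC r / ouSigma r)
  have hm2 := measurable_postMean (μ := μ) (ouC s / ouSigma s)
  have hX1 := hX.measurable s.toNNReal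
  have hX2 := hX.measurable r.toNNReal
  refine (lintegral_mono hpt).trans_eq ?_
  rw [lintegral_add_right _ (by fun_prop), lintegral_const_mul' _ _ (by simp),
    lintegral_const_mul' _ _ ENNReal.ofReal_ne_top, lintegral_postMean_sub_sq hμ hX hs0 hsr,
    ← ENNReal.ofReal_mul (by positivity)]

end Loss

/-! ### Summation over all steps. -/

theorem lemma6p2 (α β : ℕ) :
    ∃ C : ℝ≥0, ∀ (D d : ℕ) (μ : Measure (Amb D)) [IsProbabilityMeasure μ] (Clog : ℝ)
      (M : Set (Amb D)) (τ LM : ℝ) (p : Amb D → ℝ) (_ : IsAdmissible d α β μ Clog M τ LM p)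
      (Ω : Type*) [MeasurableSpace Ω] (P : Measure Ω) [IsProbabilityMeasure P]
      (X : ℝ≥0 → Ω → Amb D) (_ : IsForwardProcess μ X P)
      (shat : ℝ → Amb D → Amb D) (_ : ∀ r, Measurable (shat r))
      (κ Thi Tlo : ℝ) (K L : ℕ) (t : ℕ → ℝ),
      0 < κ → κ < 1 / 4 → 0 < Tlo → Tlo < Thi → 1 ≤ Thi →
      IsDecreasingPartition κ Thi Tlo K t →
      L ≤ K → (∀ k < L, 1 ≤ Thi - t k) → (∀ k < K, L ≤ k → Thi - t k ≤ 1) →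
      modifiedLoss P μ X shat Thi K t ≤
        (C : ℝ≥0∞) * (scoreErrorSq P μ X shat Thi K t +
          ENNReal.ofReal ((K : ℝ) * κ ^ 2 * (Clog ^ 3 + Real.log κ⁻¹ ^ 3) +
            (d : ℝ) ^ 3 * κ ^ 5 * ((K : ℝ) - (L : ℝ)) ^ 4)) := by
  -- `8 * 4000` from the increment term and `sum_grid_le`; it also exceeds the factor `72` of the
  -- score error.
  refine ⟨32000, ?_⟩
  intro D d μ _ Clog M τ LM p h Ω _ P _ X hX shat _ κ Thi Tlo K L t hκ0 hκ hTlo _ hThi ht hLK hL1 _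
  have hμ : ∀ᵐ y ∂μ, ‖y‖ ≤ 1 := h.ae_norm_le.mono fun y hy => hy.2
  set V : ℝ → ℝ := fun s => mmse μ (ouC s / ouSigma s) with hV
  set r : ℕ → ℝ := fun k => Thi - t k with hr
  have hC := h.log_complexity.gt_max
  have hrK : r K = Tlo := by simp only [hr]; rw [ht.last]; ring
  have hr0 : 1 ≤ r 0 := by simp only [hr]; rw [ht.zero]; linarith
  have hlt : ∀ k < K, r (k + 1) ≤ r k := fun k hk => by
    simp only [hr]; linarith [ht.strict k hk]
  have hstep : ∀ k < K, r k - r (k + 1) ≤ κ * min 1 (r k) := fun k hk => by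
    have := ht.step k hk
    simp only [hr]; linarith
  have hpos : ∀ k ≤ K, 0 < r k := by
    intro k hk
    refine Nat.decreasingInduction' (fun i hi _ h0 => h0.trans_le (hlt i hi)) hk ?_
    rw [hrK]; exact hTlo
  have hmono : ∀ s t, 0 < s → s ≤ t → V s ≤ V t := fun s t h0 h1 => mmse_ou_mono hμ h0 h1
  have hsum := sum_grid_le (V := V) (L := L) (d := d) (Clog := Clog) hκ0 hκ hr0 hpos hlt hstep hLK
    hL1 (fun s => mmse_nonneg _) (fun s => mmse_le_four hμ _) hmono
    (fun s t h0 h1 => mmse_ou_lipschitz hμ h0 h1) (fun s h0 h1 => mmse_ou_le h h0 h1)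
    ((le_max_right _ _).trans_lt hC) ((le_max_left _ _).trans_lt hC).le
  have hdiff : ∀ k < K, 0 ≤ r k - r (k + 1) := fun k hk => sub_nonneg.2 (hlt k hk)
  have hterm : ∀ k ∈ Finset.range K, 0 ≤ (r k - r (k + 1)) / min 1 (r k) ^ 2 *
      (V (r k) - V (r (k + 1))) := by
    intro k hk
    have hk' := Finset.mem_range.1 hk
    exact mul_nonneg (div_nonneg (hdiff k hk') (by positivity))
      (sub_nonneg.2 (hmono _ _ (hpos _ (by omega)) (hlt k hk')))
  have hbound : ∀ k ∈ Finset.range K,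
      ∫⁻ s in Set.Icc (Thi - t (k + 1)) (Thi - t k),
        ∫⁻ ω, ‖modifiedScore shat (Thi - t k) s (X s.toNNReal ω) (X (Thi - t k).toNNReal ω) -
          score μ s (X s.toNNReal ω)‖ₑ ^ 2 ∂P ≤
      72 * (ENNReal.ofReal (t (k + 1) - t k) *
        ∫⁻ ω, ‖shat (Thi - t k) (X (Thi - t k).toNNReal ω) -
          score μ (Thi - t k) (X (Thi - t k).toNNReal ω)‖ₑ ^ 2 ∂P) +
      8 * ENNReal.ofReal ((r k - r (k + 1)) / min 1 (r k) ^ 2 * (V (r k) - V (r (k + 1)))) := by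
    intro k hk
    have hk' := Finset.mem_range.1 hk
    have h0 := hpos k hk'.le
    have h1 := hpos (k + 1) (by omega)
    have hρ : 0 < min 1 (r k) := lt_min one_pos h0
    have hmem : ∀ s ∈ Set.Icc (r (k + 1)) (r k),
        ∫⁻ ω, ‖modifiedScore shat (r k) s (X s.toNNReal ω) (X (r k).toNNReal ω) -
          score μ s (X s.toNNReal ω)‖ₑ ^ 2 ∂P ≤
        72 * ∫⁻ ω, ‖shat (r k) (X (r k).toNNReal ω) -
          score μ (r k) (X (r k).toNNReal ω)‖ₑ ^ 2 ∂P +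
        ENNReal.ofReal (8 / min 1 (r k) ^ 2 * (V (r k) - V (r (k + 1)))) := by
      intro s hs
      have h2 : κ * min 1 (r k) ≤ 1 / 4 * min 1 (r k) := by gcongr
      refine (lintegral_modifiedScore_sub_score_le hμ hX shat h0 hs.2
        (by linarith [hs.1, hstep k hk'])).trans ?_
      gcongr
      -- Monotonicity replaces `V s` by its value at the lower endpoint, so the integrand is bounded
      -- by a constant on the whole step.
      exact hmono _ _ h1 hs.1
    refine (setLIntegral_mono' measurableSet_Icc hmem).trans_eq ?_
    have e : Thi - t k - (Thi - t (k + 1)) = t (k + 1) - t k := by ring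
    have e' : r k - r (k + 1) = t (k + 1) - t k := e
    have e8 : ENNReal.ofReal (8 / min 1 (r k) ^ 2 * (V (r k) - V (r (k + 1)))) *
        ENNReal.ofReal (r k - r (k + 1)) =
        8 * ENNReal.ofReal ((r k - r (k + 1)) / min 1 (r k) ^ 2 * (V (r k) - V (r (k + 1)))) := by
      have h8 : (8 : ℝ≥0∞) = ENNReal.ofReal 8 := by simp
      rw [h8, ← ENNReal.ofReal_mul' (hdiff k hk'), ← ENNReal.ofReal_mul (by norm_num)]
      congr 1; ring
    rw [setLIntegral_const, Real.volume_Icc, add_mul, e8, e']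
    congr 1
    ring
  refine (Finset.sum_le_sum hbound).trans ?_
  rw [Finset.sum_add_distrib, ← Finset.mul_sum, ← Finset.mul_sum,
    ← ENNReal.ofReal_sum_of_nonneg hterm, mul_add]
  refine add_le_add ?_ ?_
  · rw [scoreErrorSq]
    gcongr
    norm_num
  · have hlogκ : 0 ≤ Real.log κ⁻¹ :=
      Real.log_nonneg ((one_le_inv₀ hκ0).2 (by linarith))
    have h8 : (8 : ℝ≥0∞) = ENNReal.ofReal 8 := by simp
    have hc : (((32000 : ℝ≥0) : ℝ≥0∞)) = ENNReal.ofReal 32000 := by simp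
    rw [h8, hc, ← ENNReal.ofReal_mul (by norm_num), ← ENNReal.ofReal_mul (by norm_num)]
    refine ENNReal.ofReal_le_ofReal ?_
    -- The estimate holds without the `log³ κ⁻¹` term, which is only added as a nonnegative
    -- quantity.
    have h9 : 0 ≤ (K : ℝ) * κ ^ 2 * Real.log κ⁻¹ ^ 3 := by positivity
    rw [mul_add ((K : ℝ) * κ ^ 2)]
    linarith
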